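/- Let $w=\{w_k\}_{k\ge 1}$ be a sequence of positive numbers with $\lim_{k\to\infty} w_k=1$, and let $\beta_0=1$, $\beta_k=\prod_{j=1}^k w_j$ for $k\ge 1$. Let $H^2_\beta$ be the weighted Hardy space of all power series $f(z)=\sum_{k\ge 0}\widehat f(k)z^k$ with $\sum_{k\ge 0}\beta_k^2|\widehat f(k)|^2<\infty$ (they converge in the open unit disk $\mathbb D$), with the inner product $\langle f,g\rangle=\sum_{k\ge 0}\beta_k^2\,\widehat f(k)\,\overline{\widehat g(k)}$. Suppose that $H^2_\beta$ is of polynomial growth, that is, $\sup_{k\ge 1}(k+1)|w_k-1|<\infty$. Let $\varphi$ be a parabolic disk automorphism, that is, an analytic bijection of $\mathbb D$ onto itself which (continued analytically to a neighbourhood of $\overline{\mathbb D}$) has exactly one fixed point on the unit circle, this fixed point being of multiplicity $2$. Then the composition operator $C_\varphi f=f\circ\varphi$ is a bounded linear operator on $H^2_\beta$, and its spectrum is exactly the unit circle: $$\sigma(C_\varphi)=\{\lambda\in\mathbb C:\ |\lambda|=1\}.$$ -/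

import Mathlib

open scoped Topology ComplexConjugate

noncomputable section

/-- A sequence `w 1, w 2, …` of positive numbers that tends to `1`
(the value `w 0` is never used). -/
structure WeightSequence where
  w : ℕ → ℝ
  pos : ∀ k, 1 ≤ k → 0 < w k
  tendsto_one : Filter.Tendsto w Filter.atTop (𝓝 1)

namespace WeightSequence

/-- `β 0 = 1` and `β k = w 1 * ⋯ * w k`. -/
def β (W : WeightSequence) (k : ℕ) : ℝ := ∏ j ∈ Finset.Icc 1 k, W.w j

/-- Polynomial growth: `sup_{k ≥ 1} (k + 1) |w k - 1| < ∞`. -/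
def PolynomialGrowth (W : WeightSequence) : Prop :=
  ∃ M : ℝ, ∀ k : ℕ, 1 ≤ k → ((k : ℝ) + 1) * |W.w k - 1| ≤ M

theorem β_pos (W : WeightSequence) (k : ℕ) : 0 < W.β k :=
  Finset.prod_pos fun j hj => W.pos j (Finset.mem_Icc.mp hj).1

end WeightSequence

/-- The sequences of Taylor coefficients with `∑ β k ^ 2 * |a k| ^ 2 < ∞`. -/
def hardyCoefficients (W : WeightSequence) : Submodule ℂ (ℕ → ℂ) where
  carrier := {a | Summable fun k => W.β k ^ 2 * ‖a k‖ ^ 2}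
  zero_mem' := by simp
  add_mem' := by
    intro a b ha hb
    refine Summable.of_nonneg_of_le (fun k => by positivity) (fun k => ?_)
      ((ha.add hb).mul_left 2)
    have h1 : ‖(a + b) k‖ ^ 2 ≤ 2 * (‖a k‖ ^ 2 + ‖b k‖ ^ 2) := by
      have h2 : ‖(a + b) k‖ ^ 2 ≤ (‖a k‖ + ‖b k‖) ^ 2 := by
        gcongr
        exact norm_add_le _ _
      nlinarith [sq_nonneg (‖a k‖ - ‖b k‖)]
    nlinarith [mul_le_mul_of_nonneg_left h1 (sq_nonneg (W.β k))]
  smul_mem' := by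
    intro c a ha
    have h := Summable.mul_left (‖c‖ ^ 2) ha
    refine h.congr fun k => ?_
    simp only [Pi.smul_apply, smul_eq_mul, norm_mul]
    ring

/-- The weighted Hardy space: all power series `f(z) = ∑ f.coeff k * z ^ k` with
`∑ β k ^ 2 * |f.coeff k| ^ 2 < ∞`. Its norm and inner product are the weighted ones below,
and it is coerced to functions by summing the series. -/
def WeightedHardySpace (W : WeightSequence) : Type := ↥(hardyCoefficients W)

namespace WeightedHardySpace

variable {W : WeightSequence}

instance : AddCommGroup (WeightedHardySpace W) :=
  inferInstanceAs (AddCommGroup ↥(hardyCoefficients W))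

instance : Module ℂ (WeightedHardySpace W) :=
  inferInstanceAs (Module ℂ ↥(hardyCoefficients W))

/-- The `k`-th Taylor coefficient. -/
def coeff (f : WeightedHardySpace W) (k : ℕ) : ℂ := f.1 k

theorem ext_coeff {f g : WeightedHardySpace W} (h : ∀ k, f.coeff k = g.coeff k) : f = g :=
  Subtype.ext (funext h)

theorem coeff_zero (k : ℕ) : (0 : WeightedHardySpace W).coeff k = 0 := rfl

theorem coeff_add (f g : WeightedHardySpace W) (k : ℕ) :
    (f + g).coeff k = f.coeff k + g.coeff k := rfl

theorem coeff_smul (c : ℂ) (f : WeightedHardySpace W) (k : ℕ) :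
    (c • f).coeff k = c * f.coeff k := rfl

theorem summable_norm (f : WeightedHardySpace W) :
    Summable fun k => W.β k ^ 2 * ‖f.coeff k‖ ^ 2 := f.2

theorem summable_inner (f g : WeightedHardySpace W) :
    Summable fun k => (W.β k : ℂ) ^ 2 * (conj (f.coeff k) * g.coeff k) := by
  refine Summable.of_norm_bounded (f.summable_norm.add g.summable_norm) fun k => ?_
  simp only [norm_mul, norm_pow, Complex.norm_real, RCLike.norm_conj, Real.norm_eq_abs, sq_abs]
  have h : ‖f.coeff k‖ * ‖g.coeff k‖ ≤ ‖f.coeff k‖ ^ 2 + ‖g.coeff k‖ ^ 2 := by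
    nlinarith [sq_nonneg (‖f.coeff k‖ - ‖g.coeff k‖), sq_nonneg ‖f.coeff k‖,
      sq_nonneg ‖g.coeff k‖]
  nlinarith [mul_le_mul_of_nonneg_left h (sq_nonneg (W.β k))]

/-- The inner product `∑ β k ^ 2 * conj (f.coeff k) * g.coeff k`
(linear in the second variable, as everywhere in Mathlib). -/
instance : Inner ℂ (WeightedHardySpace W) where
  inner f g := ∑' k, (W.β k : ℂ) ^ 2 * (conj (f.coeff k) * g.coeff k)

theorem inner_def (f g : WeightedHardySpace W) :
    inner ℂ f g = ∑' k, (W.β k : ℂ) ^ 2 * (conj (f.coeff k) * g.coeff k) := rfl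

theorem inner_self_eq (f : WeightedHardySpace W) :
    inner ℂ f f = ((∑' k, W.β k ^ 2 * ‖f.coeff k‖ ^ 2 : ℝ) : ℂ) := by
  rw [inner_def, Complex.ofReal_tsum]
  refine tsum_congr fun k => ?_
  rw [Complex.conj_mul']
  push_cast
  ring

/-- The inner product satisfies the axioms. -/
@[reducible]
def innerCore (W : WeightSequence) : InnerProductSpace.Core ℂ (WeightedHardySpace W) where
  inner := inner ℂ
  conj_inner_symm f g := by
    rw [inner_def, inner_def, Complex.conj_tsum]
    refine tsum_congr fun k => ?_
    simp only [map_mul, map_pow, Complex.conj_ofReal, Complex.conj_conj]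
    ring
  re_inner_nonneg f := by
    rw [inner_self_eq]
    simp only [RCLike.re_to_complex, Complex.ofReal_re]
    exact tsum_nonneg fun k => by positivity
  add_left f g h := by
    rw [inner_def, inner_def, inner_def, ← (summable_inner f h).tsum_add (summable_inner g h)]
    refine tsum_congr fun k => ?_
    rw [coeff_add, map_add]
    ring
  smul_left f g c := by
    rw [inner_def, inner_def, ← tsum_mul_left]
    refine tsum_congr fun k => ?_
    rw [coeff_smul, map_mul]
    ring
  definite f hf := by
    rw [inner_self_eq, Complex.ofReal_eq_zero] at hf
    have h0 := (hasSum_zero_iff_of_nonneg (fun k => by positivity)).1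
      (hf ▸ f.summable_norm.hasSum)
    refine ext_coeff fun k => ?_
    have hk := congrFun h0 k
    rw [coeff_zero]
    simpa [(W.β_pos k).ne'] using hk

instance : NormedAddCommGroup (WeightedHardySpace W) :=
  (innerCore W).toNormedAddCommGroup

instance : InnerProductSpace ℂ (WeightedHardySpace W) :=
  InnerProductSpace.ofCore (innerCore W).toCore

theorem norm_sq_eq (f : WeightedHardySpace W) :
    ‖f‖ ^ 2 = ∑' k, W.β k ^ 2 * ‖f.coeff k‖ ^ 2 := by
  have h := inner_self_eq_norm_sq_to_K (𝕜 := ℂ) f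
  rw [inner_self_eq] at h
  refine Complex.ofReal_injective (Eq.trans ?_ h.symm)
  rw [Complex.ofReal_pow]
  rfl

/-- An element of the space as a function, the sum of its power series.
The series converges in the open unit disk (see `hasSum_apply`);
the values outside the disk have no meaning. -/
instance : CoeFun (WeightedHardySpace W) fun _ => ℂ → ℂ where
  coe f z := ∑' k, f.coeff k * z ^ k

theorem hasSum_apply (f : WeightedHardySpace W) {z : ℂ} (hz : z ∈ Metric.ball (0 : ℂ) 1) :
    HasSum (fun k => f.coeff k * z ^ k) (f z) := by
  refine Summable.hasSum ?_
  rw [mem_ball_zero_iff] at hz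
  by_cases hz0 : z = 0
  · subst hz0
    refine summable_of_ne_finset_zero (s := {0}) fun k hk => ?_
    rw [zero_pow (by simpa using hk), mul_zero]
  have hzpos : 0 < ‖z‖ := norm_pos_iff.mpr hz0
  have hg : Summable fun k => ‖z‖ ^ k / W.β k := by
    refine summable_of_ratio_test_tendsto_lt_one hz
      (Filter.Eventually.of_forall fun k => (div_pos (pow_pos hzpos k) (W.β_pos k)).ne') ?_
    have h1 : Filter.Tendsto (fun k => ‖z‖ / W.w (k + 1)) Filter.atTop (𝓝 (‖z‖ / 1)) :=
      tendsto_const_nhds.div ((Filter.tendsto_add_atTop_iff_nat 1).2 W.tendsto_one) one_ne_zero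
    rw [div_one] at h1
    refine h1.congr fun k => ?_
    have hw : 0 < W.w (k + 1) := W.pos _ (by omega)
    have hb := W.β_pos k
    have hβ : W.β (k + 1) = W.β k * W.w (k + 1) :=
      Finset.prod_Icc_succ_top (by omega) _
    rw [Real.norm_of_nonneg (by have := W.β_pos (k + 1); positivity),
      Real.norm_of_nonneg (by positivity), hβ, pow_succ]
    field_simp
  refine Summable.of_norm_bounded (hg.mul_left ‖f‖) fun k => ?_
  have hb := W.β_pos k
  have h2 : W.β k * ‖f.coeff k‖ ≤ ‖f‖ := by
    refine le_of_sq_le_sq ?_ (norm_nonneg f)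
    rw [norm_sq_eq, mul_pow]
    exact f.summable_norm.le_tsum k fun j _ => by positivity
  rw [norm_mul, norm_pow, mul_div_assoc', le_div_iff₀ hb]
  calc ‖f.coeff k‖ * ‖z‖ ^ k * W.β k = W.β k * ‖f.coeff k‖ * ‖z‖ ^ k := by ring
    _ ≤ ‖f‖ * ‖z‖ ^ k := by gcongr

end WeightedHardySpace

/-- `φ` restricts to an analytic bijection of the open unit disk onto itself. -/
def IsDiskAutomorphism (φ : ℂ → ℂ) : Prop :=
  DifferentiableOn ℂ φ (Metric.ball 0 1) ∧
    Set.BijOn φ (Metric.ball 0 1) (Metric.ball 0 1)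

/-- A disk automorphism `φ` is parabolic if it has exactly one fixed point on the unit circle,
and this fixed point has multiplicity two. Here `φ` is continued analytically
to a neighbourhood of the closed disk. -/
def IsParabolicAutomorphism (φ : ℂ → ℂ) : Prop :=
  IsDiskAutomorphism φ ∧
    ∃ Φ : ℂ → ℂ, AnalyticOnNhd ℂ Φ (Metric.closedBall 0 1) ∧
      Set.EqOn Φ φ (Metric.ball 0 1) ∧
      ∃ ζ : ℂ, {z ∈ Metric.sphere (0 : ℂ) 1 | Φ z = z} = {ζ} ∧
        analyticOrderAt (fun z => Φ z - z) ζ = 2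

/-- The bounded operator `T` is the composition operator `f ↦ f ∘ φ` on the weighted Hardy
space. -/
def IsCompositionOperator (W : WeightSequence) (φ : ℂ → ℂ)
    (T : WeightedHardySpace W →L[ℂ] WeightedHardySpace W) : Prop :=
  ∀ f : WeightedHardySpace W, ∀ z ∈ Metric.ball (0 : ℂ) 1, (T f) z = f (φ z)

end

/-! Boundedness comes from an energy estimate. For `φ_s z = (z + s) / (1 + s z)`, the functions `f ∘
φ_s` solve the flow equation `(1 - s²) ∂_s g = (1 - z²) g'`. On Taylor coefficients the field `(1 -
z²) d/dz` is skew-adjoint up to a bounded error: summation by parts leaves the terms `(β_k² (k + 1)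
- β_{k+1}² k) Re (conj a_k a_{k+1})`, and polynomial growth bounds the bracket by `K β_k β_{k+1}`.
Gronwall then gives `‖C_{φ_s}‖ ≤ exp (K s / (1 - s²))`. Rotations are isometries, so every disk
automorphism acts boundedly, with norm close to `1` if it moves the origin only a little.

In the half-plane coordinate `(1 + z) / (1 - z)` a parabolic automorphism fixing `1` is the
translation `u ↦ u + iτ`. Dilations conjugate it to arbitrarily short translations, so `C_φ` is
similar to operators of norm at most `1 + ε`, and so is its inverse. Hence the powers of both grow
subexponentially and the spectrum lies on the unit circle.

Conversely, suppose `|μ| = 1` and `μ` is not in the spectrum. The expansions of the resolvent from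
outside and from inside the circle then have a common limit at `μ`. Testing with `f = (1 - z)²` at
the origin gives `∑_{n ∈ ℤ} μ⁻ⁿ (1 + i n τ / 2)⁻² = 0`. By Poisson summation, for `τ > 0`, this sum
is a positive multiple of `∑_n h (x + n)` with `h x = x₊ e^{-αx}`, which is strictly positive;
negative `τ` follows by reflection. -/

namespace WeightedHardySpace

/-! ### The Hilbert space: completeness, point evaluations, polynomials -/

variable {W : WeightSequence}

/-- The isometry `f ↦ (β k * f.coeff k)` onto `ℓ²`. -/
noncomputable def toL2 (W : WeightSequence) : WeightedHardySpace W ≃ₗᵢ[ℂ] lp (fun _ : ℕ => ℂ) 2 where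
  toFun f := ⟨fun k => W.β k * f.coeff k, by
    refine memℓp_gen ?_
    refine f.summable_norm.congr fun k => ?_
    simp [mul_pow, abs_of_pos (W.β_pos k)]⟩
  invFun g := ⟨fun k => g k / W.β k, by
    have h := (lp.memℓp g).summable (by norm_num)
    refine h.congr fun k => ?_
    have := (W.β_pos k).ne'
    simp only [ENNReal.toReal_ofNat, Real.rpow_ofNat, norm_div, Complex.norm_real, Real.norm_eq_abs,
      div_pow, sq_abs]
    field_simp⟩
  map_add' f g := by
    ext k
    simp [coeff_add, mul_add]
    rfl
  map_smul' c f := by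
    ext k
    simp [coeff_smul, mul_left_comm]
  left_inv f := by
    refine ext_coeff fun k => ?_
    have : (W.β k : ℂ) ≠ 0 := by exact_mod_cast (W.β_pos k).ne'
    change (W.β k : ℂ) * f.coeff k / W.β k = f.coeff k
    field_simp
  right_inv g := by
    ext k
    have : (W.β k : ℂ) ≠ 0 := by exact_mod_cast (W.β_pos k).ne'
    change (W.β k : ℂ) * (g k / W.β k) = g k
    field_simp
  norm_map' f := by
    refine (sq_eq_sq₀ (norm_nonneg _) (norm_nonneg _)).1 ?_
    rw [norm_sq_eq]
    have h := lp.norm_rpow_eq_tsum (p := 2) (E := fun _ : ℕ => ℂ) (by norm_num)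
      ⟨fun k => (W.β k : ℂ) * f.coeff k, by
        refine memℓp_gen ?_
        refine f.summable_norm.congr fun k => ?_
        simp [mul_pow, abs_of_pos (W.β_pos k)]⟩
    simp only [ENNReal.toReal_ofNat, Real.rpow_ofNat] at h
    refine h.trans (tsum_congr fun k => ?_)
    simp [mul_pow]

/-- Completeness serves to extend operators from the polynomials and to make the bounded operators a
Banach algebra. -/
instance : CompleteSpace (WeightedHardySpace W) :=
  (toL2 W).toIsometryEquiv.completeSpace

theorem norm_coeff_le (f : WeightedHardySpace W) (k : ℕ) : W.β k * ‖f.coeff k‖ ≤ ‖f‖ := by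
  refine le_of_sq_le_sq ?_ (norm_nonneg f)
  rw [norm_sq_eq, mul_pow]
  exact f.summable_norm.le_tsum k fun j _ => by positivity

theorem summable_pow_div_β (W : WeightSequence) {r : ℝ} (hr0 : 0 ≤ r) (hr : r < 1) :
    Summable fun k => r ^ k / W.β k := by
  rcases hr0.eq_or_lt with rfl | hpos
  · refine summable_of_ne_finset_zero (s := {0}) fun k hk => ?_
    rw [zero_pow (by simpa using hk), zero_div]
  refine summable_of_ratio_test_tendsto_lt_one hr
    (Filter.Eventually.of_forall fun k => (div_pos (pow_pos hpos k) (W.β_pos k)).ne') ?_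
  have h1 : Filter.Tendsto (fun k => r / W.w (k + 1)) Filter.atTop (𝓝 (r / 1)) :=
    tendsto_const_nhds.div ((Filter.tendsto_add_atTop_iff_nat 1).2 W.tendsto_one) one_ne_zero
  rw [div_one] at h1
  refine h1.congr fun k => ?_
  have hw : 0 < W.w (k + 1) := W.pos _ (by omega)
  have hb := W.β_pos k
  have hβ : W.β (k + 1) = W.β k * W.w (k + 1) := Finset.prod_Icc_succ_top (by omega) _
  rw [Real.norm_of_nonneg (by have := W.β_pos (k + 1); positivity),
    Real.norm_of_nonneg (by positivity), hβ, pow_succ]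
  field_simp

/-- Point evaluation in the disk is bounded. -/
theorem norm_apply_le (f : WeightedHardySpace W) {z : ℂ} (hz : ‖z‖ < 1) :
    ‖f z‖ ≤ (∑' k, ‖z‖ ^ k / W.β k) * ‖f‖ := by
  have hs := summable_pow_div_β W (norm_nonneg z) hz
  rw [← tsum_mul_right]
  refine tsum_of_norm_bounded (hs.mul_right ‖f‖).hasSum fun k => ?_
  have hb := W.β_pos k
  rw [norm_mul, norm_pow, div_mul_eq_mul_div, le_div_iff₀ hb]
  calc ‖f.coeff k‖ * ‖z‖ ^ k * W.β k = ‖z‖ ^ k * (W.β k * ‖f.coeff k‖) := by ring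
    _ ≤ ‖z‖ ^ k * ‖f‖ := by gcongr; exact norm_coeff_le f k

theorem apply_add (f g : WeightedHardySpace W) {z : ℂ} (hz : ‖z‖ < 1) :
    (f + g) z = f z + g z := by
  have hz' : z ∈ Metric.ball (0 : ℂ) 1 := by simpa using hz
  refine (((hasSum_apply f hz').add (hasSum_apply g hz')).congr_fun fun k => ?_).tsum_eq
  rw [coeff_add, add_mul]

theorem apply_smul (c : ℂ) (f : WeightedHardySpace W) (z : ℂ) :
    (c • f) z = c * f z := by
  rw [← tsum_mul_left]
  refine tsum_congr fun k => ?_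
  rw [coeff_smul, mul_assoc]

/-- Point evaluation in the disk as a continuous linear functional. -/
noncomputable def evalL (W : WeightSequence) (z : ℂ) (hz : ‖z‖ < 1) :
    WeightedHardySpace W →L[ℂ] ℂ :=
  LinearMap.mkContinuous
    { toFun := fun f => f z
      map_add' := fun f g => apply_add f g hz
      map_smul' := fun c f => apply_smul c f z } _ fun f => norm_apply_le f hz

/-- An element of the space is determined by its values in the disk. -/
theorem ext_apply {f g : WeightedHardySpace W} (h : ∀ z ∈ Metric.ball (0 : ℂ) 1, f z = g z) :
    f = g := by
  have key : ∀ f : WeightedHardySpace W,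
      HasFPowerSeriesAt (fun z => f z) (FormalMultilinearSeries.ofScalars ℂ f.coeff) 0 := by
    intro f
    rw [hasFPowerSeriesAt_iff]
    filter_upwards [Metric.ball_mem_nhds (0 : ℂ) one_pos] with z hz
    have := hasSum_apply f hz
    simpa [FormalMultilinearSeries.coeff_ofScalars, mul_comm] using this
  have h2 := ((key g).congr (by
    filter_upwards [Metric.ball_mem_nhds (0 : ℂ) one_pos] with z hz
    exact (h z hz).symm)).eq_formalMultilinearSeries (key f)
  refine ext_coeff fun k => ?_
  have := congrArg (fun p => p.coeff k) h2
  simpa [FormalMultilinearSeries.coeff_ofScalars] using this.symm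

/-- Polynomials as elements of the space. -/
noncomputable def ofPoly (W : WeightSequence) : Polynomial ℂ →ₗ[ℂ] WeightedHardySpace W where
  toFun P := ⟨P.coeff, by
    refine summable_of_ne_finset_zero (s := P.support) fun k hk => ?_
    rw [Polynomial.notMem_support_iff.1 hk]
    simp⟩
  map_add' P Q := ext_coeff fun k => Polynomial.coeff_add P Q k
  map_smul' c P := ext_coeff fun k => Polynomial.coeff_smul c P k

@[simp]
theorem coeff_ofPoly (P : Polynomial ℂ) (k : ℕ) : (ofPoly W P).coeff k = P.coeff k := rfl

theorem ofPoly_apply (P : Polynomial ℂ) (z : ℂ) : (ofPoly W P) z = P.eval z := by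
  rw [Polynomial.eval_eq_sum, Polynomial.sum]
  refine tsum_eq_sum fun k hk => ?_
  rw [coeff_ofPoly, Polynomial.notMem_support_iff.1 hk, zero_mul]

theorem denseRange_ofPoly (W : WeightSequence) : DenseRange (ofPoly W) := by
  intro f
  have hs := (lp.hasSum_single (p := 2) (by norm_num) (toL2 W f)).mapL
    ((toL2 W).symm.toContinuousLinearEquiv : lp (fun _ : ℕ => ℂ) 2 →L[ℂ] WeightedHardySpace W)
  have hf : ((toL2 W).symm.toContinuousLinearEquiv :
      lp (fun _ : ℕ => ℂ) 2 →L[ℂ] WeightedHardySpace W) (toL2 W f) = f :=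
    (toL2 W).symm_apply_apply f
  rw [hf] at hs
  have hmem : ∀ k : ℕ, ((toL2 W).symm.toContinuousLinearEquiv :
      lp (fun _ : ℕ => ℂ) 2 →L[ℂ] WeightedHardySpace W) (lp.single 2 k (toL2 W f k)) ∈
      LinearMap.range (ofPoly W) := by
    intro k
    refine ⟨Polynomial.monomial k (toL2 W f k / W.β k), ext_coeff fun j => ?_⟩
    rw [coeff_ofPoly, Polynomial.coeff_monomial]
    change _ = (lp.single 2 k (toL2 W f k) : lp (fun _ : ℕ => ℂ) 2) j / (W.β j : ℂ)
    by_cases h : k = j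
    · subst h
      simp
    · rw [if_neg h, lp.single_apply_ne _ _ _ (Ne.symm h), zero_div]
  have h3 : f ∈ (LinearMap.range (ofPoly W)).topologicalClosure :=
    (Submodule.isClosed_topologicalClosure _).mem_of_tendsto hs
      (Filter.Eventually.of_forall fun s => Submodule.sum_mem _ fun k _ =>
        Submodule.le_topologicalClosure _ (hmem k))
  exact h3

end WeightedHardySpace

/-! ### The flow equation on Taylor coefficients -/

open PowerSeries in
/-- Coefficientwise derivative of a family of power series. -/
def HasCoeffDerivAt (F : ℝ → PowerSeries ℂ) (F' : PowerSeries ℂ) (s : ℝ) : Prop :=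
  ∀ k, HasDerivAt (fun t => coeff k (F t)) (coeff k F') s

namespace HasCoeffDerivAt

open PowerSeries

variable {F G : ℝ → PowerSeries ℂ} {F' G' : PowerSeries ℂ} {s : ℝ}

theorem unique (h₁ : HasCoeffDerivAt F F' s) (h₂ : HasCoeffDerivAt F G' s) : F' = G' := by
  ext k
  exact (h₁ k).unique (h₂ k)

theorem const (A : PowerSeries ℂ) (s : ℝ) : HasCoeffDerivAt (fun _ => A) 0 s := by
  intro k
  simpa using hasDerivAt_const s (coeff k A)

theorem ofReal (s : ℝ) : HasCoeffDerivAt (fun t => C (t : ℂ)) 1 s := by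
  intro k
  simp only [coeff_C, coeff_one]
  split_ifs
  · exact Complex.ofRealCLM.hasDerivAt
  · exact hasDerivAt_const _ _

theorem add (hF : HasCoeffDerivAt F F' s) (hG : HasCoeffDerivAt G G' s) :
    HasCoeffDerivAt (fun t => F t + G t) (F' + G') s := by
  intro k
  simpa using (hF k).fun_add (hG k)

theorem mul (hF : HasCoeffDerivAt F F' s) (hG : HasCoeffDerivAt G G' s) :
    HasCoeffDerivAt (fun t => F t * G t) (F' * G s + F s * G') s := by
  intro k
  simp only [map_add, coeff_mul, ← Finset.sum_add_distrib]
  exact HasDerivAt.fun_sum fun p _ => (hF p.1).fun_mul (hG p.2)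

theorem aeval (hF : HasCoeffDerivAt F F' s) (P : Polynomial ℂ) :
    HasCoeffDerivAt (fun t => Polynomial.aeval (F t) P)
      (Polynomial.aeval (F s) (Polynomial.derivative P) * F') s := by
  induction P using Polynomial.induction_on with
  | C a => simpa using const _ s
  | add p q hp hq => simpa [add_mul] using hp.add hq
  | monomial n a ih =>
    have h := ih.mul hF
    simp only [pow_succ, ← mul_assoc, map_mul, Polynomial.derivative_mul, map_add,
      Polynomial.aeval_X, Polynomial.derivative_X, mul_one] at h ⊢
    convert h using 1
    ring

end HasCoeffDerivAt

/-- The expansion of `1 / (1 + s z)`. -/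
noncomputable def invSeries (s : ℝ) : PowerSeries ℂ := PowerSeries.mk fun k => (-(s : ℂ)) ^ k

/-- The expansion of `(z + s) / (1 + s z)`. -/
noncomputable def shiftSeries (s : ℝ) : PowerSeries ℂ :=
  (PowerSeries.X + PowerSeries.C (s : ℂ)) * invSeries s

section series

open PowerSeries

theorem invSeries_mul (s : ℝ) : invSeries s * (1 + C (s : ℂ) * X) = 1 := by
  ext k
  rw [mul_add, mul_one, ← mul_assoc, map_add]
  cases k with
  | zero => simp [invSeries]
  | succ k =>
    rw [coeff_succ_mul_X, mul_comm, coeff_C_mul]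
    simp [invSeries, coeff_one, pow_succ]
    ring

theorem derivative_invSeries (s : ℝ) :
    d⁄dX ℂ (invSeries s) = - C (s : ℂ) * invSeries s ^ 2 := by
  have h := congrArg (d⁄dX ℂ) (invSeries_mul s)
  have h1 := invSeries_mul s
  simp only [Derivation.leibniz, smul_eq_mul, map_add, Derivation.map_one_eq_zero, derivative_C,
    derivative_X, mul_zero, add_zero, mul_one, zero_add] at h
  linear_combination invSeries s * h - (d⁄dX ℂ (invSeries s)) * h1

theorem hasCoeffDerivAt_invSeries (s : ℝ) :
    HasCoeffDerivAt invSeries (- X * invSeries s ^ 2) s := by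
  -- Only the existence of a derivative is read off the coefficients; its value comes from
  -- differentiating `invSeries s * (1 + s X) = 1`.
  have hex : ∃ V, HasCoeffDerivAt invSeries V s := by
    refine ⟨PowerSeries.mk fun k => (k : ℂ) * (-(s : ℂ)) ^ (k - 1) * (-1), fun k => ?_⟩
    simp only [invSeries, coeff_mk]
    exact (Complex.ofRealCLM.hasDerivAt (x := s)).fun_neg.fun_pow k
  obtain ⟨V, hV⟩ := hex
  have h1 := invSeries_mul s
  have h2 := (hV.mul ((HasCoeffDerivAt.const 1 s).add
    ((HasCoeffDerivAt.ofReal s).mul (HasCoeffDerivAt.const X s))))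
  simp only [invSeries_mul] at h2
  have h3 := h2.unique (HasCoeffDerivAt.const 1 s)
  have h4 : V = - X * invSeries s ^ 2 := by
    linear_combination invSeries s * h3 - V * h1
  exact h4 ▸ hV

theorem hasCoeffDerivAt_shiftSeries (s : ℝ) :
    HasCoeffDerivAt shiftSeries ((1 - X ^ 2) * invSeries s ^ 2) s := by
  have h := ((HasCoeffDerivAt.const X s).add (HasCoeffDerivAt.ofReal s)).mul
    (hasCoeffDerivAt_invSeries s)
  have h1 := invSeries_mul s
  have h2 : (1 - X ^ 2) * invSeries s ^ 2 =
      (1 + 0 : PowerSeries ℂ) * invSeries s + (X + C (s : ℂ)) * (-X * invSeries s ^ 2) := by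
    linear_combination invSeries s * h1
  rw [h2, add_comm 1 (0 : PowerSeries ℂ)]
  exact h

theorem derivative_shiftSeries (s : ℝ) :
    d⁄dX ℂ (shiftSeries s) = C (1 - (s : ℂ) ^ 2) * invSeries s ^ 2 := by
  have h1 := invSeries_mul s
  simp only [shiftSeries, Derivation.leibniz, derivative_invSeries, smul_eq_mul, map_add,
    derivative_C, derivative_X, map_sub, map_one, map_pow]
  linear_combination -invSeries s * h1

theorem shiftSeries_zero : shiftSeries 0 = X := by
  have : invSeries 0 = 1 := by
    have := invSeries_mul 0
    simpa using this
  simp [shiftSeries, this]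

/-- Taylor coefficients of `P ((z + s) / (1 + s z))`. -/
noncomputable def shiftCoeff (P : Polynomial ℂ) (s : ℝ) (k : ℕ) : ℂ :=
  coeff k (Polynomial.aeval (shiftSeries s) P)

theorem shiftCoeff_zero (P : Polynomial ℂ) (k : ℕ) : shiftCoeff P 0 k = P.coeff k := by
  have h : Polynomial.aeval (X : PowerSeries ℂ) P = (P : PowerSeries ℂ) := by
    rw [Polynomial.aeval_def, PowerSeries.algebraMap_eq, Polynomial.eval₂_C_X_eq_coe]
  rw [shiftCoeff, shiftSeries_zero, h, Polynomial.coeff_coe]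

end series

/-- The coefficients of `(1 - z²) f'`, where `f = ∑ a k z ^ k`. -/
def flowCoeff (a : ℕ → ℂ) : ℕ → ℂ
  | 0 => a 1
  | k + 1 => (k + 2) * a (k + 2) - k * a k

-- By the chain rule the derivatives of `P ∘ φ_s` in `s` and in `z` share the factors `P' ∘ φ_s` and
-- `(1 + s z)⁻²`, so their quotient is `(1 - z²) / (1 - s²)`.
open PowerSeries in
theorem hasDerivAt_shiftCoeff (P : Polynomial ℂ) {s : ℝ} (hs : 1 - s ^ 2 ≠ 0) (k : ℕ) :
    HasDerivAt (fun t => shiftCoeff P t k)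
      (((1 - s ^ 2)⁻¹ : ℝ) * flowCoeff (shiftCoeff P s) k) s := by
  have h := (hasCoeffDerivAt_shiftSeries s).aeval P k
  have hne : (1 - (s : ℂ) ^ 2) ≠ 0 := by exact_mod_cast hs
  have h2 : Polynomial.aeval (shiftSeries s) (Polynomial.derivative P) *
      ((1 - X ^ 2) * invSeries s ^ 2) =
      C (1 - (s : ℂ) ^ 2)⁻¹ *
        ((1 - X ^ 2) * d⁄dX ℂ (Polynomial.aeval (shiftSeries s) P)) := by
    rw [Derivation.map_aeval, derivative_shiftSeries, smul_eq_mul]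
    have : C (1 - (s : ℂ) ^ 2)⁻¹ * C (1 - (s : ℂ) ^ 2) = (1 : PowerSeries ℂ) := by
      rw [← map_mul, inv_mul_cancel₀ hne, map_one]
    linear_combination (-(Polynomial.aeval (shiftSeries s) (Polynomial.derivative P) *
      ((1 - X ^ 2) * invSeries s ^ 2))) * this
  rw [h2, coeff_C_mul] at h
  have key : flowCoeff (shiftCoeff P s) k =
      coeff k ((1 - X ^ 2) * d⁄dX ℂ (Polynomial.aeval (shiftSeries s) P)) := by
    rw [sub_mul, one_mul, map_sub, coeff_derivative]
    match k with
    | 0 => simp [flowCoeff, shiftCoeff, coeff_X_pow_mul']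
    | 1 =>
      simp [flowCoeff, shiftCoeff, coeff_X_pow_mul']
      ring
    | k + 2 =>
      rw [coeff_X_pow_mul', if_pos (by omega), coeff_derivative]
      simp [flowCoeff, shiftCoeff]
      ring
  rw [key]
  push_cast
  exact h

/-! ### Geometric decay of the coefficients, uniform along the flow -/

/-- A family of power series on `[0, s₁]` whose coefficients are `O(ρ ^ k)`, uniformly in the
parameter, for every `ρ > s₁`. -/
def GeometricBound (s₁ : ℝ) (F : ℝ → PowerSeries ℂ) : Prop :=
  ∀ ρ, s₁ < ρ → ∃ C, ∀ s ∈ Set.Icc 0 s₁, ∀ k, ‖PowerSeries.coeff k (F s)‖ ≤ C * ρ ^ k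

/-- Each of the `k + 1` terms `x ^ i` with `i ≤ k` of the geometric series is at least `x ^ k`. -/
theorem succ_mul_pow_le {x : ℝ} (hx0 : 0 ≤ x) (hx : x < 1) (k : ℕ) :
    ((k : ℝ) + 1) * x ^ k ≤ (1 - x)⁻¹ := by
  have h1 : ((k : ℝ) + 1) * x ^ k ≤ ∑ i ∈ Finset.range (k + 1), x ^ i := by
    have := Finset.card_nsmul_le_sum (Finset.range (k + 1)) (fun i => x ^ i) (x ^ k)
      fun i hi => pow_le_pow_of_le_one hx0 hx.le (by simpa [Nat.lt_succ_iff] using hi)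
    simpa using this
  refine h1.trans ?_
  rw [← tsum_geometric_of_lt_one hx0 hx]
  exact (summable_geometric_of_lt_one hx0 hx).sum_le_tsum _ fun i _ => by positivity

namespace GeometricBound

open PowerSeries

variable {s₁ : ℝ} {F G : ℝ → PowerSeries ℂ}

theorem add (hF : GeometricBound s₁ F) (hG : GeometricBound s₁ G) :
    GeometricBound s₁ fun s => F s + G s := by
  intro ρ hρ
  obtain ⟨A, hA⟩ := hF ρ hρ
  obtain ⟨B, hB⟩ := hG ρ hρ
  refine ⟨A + B, fun s hs k => ?_⟩
  rw [map_add, add_mul]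
  exact norm_add_le_of_le (hA s hs k) (hB s hs k)

/-- The Cauchy product costs a factor `k + 1`. It is absorbed by using the hypotheses at some `r`
strictly between `s₁` and `ρ`, which is why the bound is required for every `ρ > s₁`. -/
theorem mul (hs₁ : 0 ≤ s₁) (hF : GeometricBound s₁ F) (hG : GeometricBound s₁ G) :
    GeometricBound s₁ fun s => F s * G s := by
  intro ρ hρ
  have hρ0 : 0 < ρ := hs₁.trans_lt hρ
  obtain ⟨r, hr, hrρ⟩ := exists_between hρ
  have hr0 : 0 < r := hs₁.trans_lt hr
  obtain ⟨A, hA⟩ := hF r hr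
  obtain ⟨B, hB⟩ := hG r hr
  have hA0 : 0 ≤ A := by
    simpa using (norm_nonneg _).trans (hA 0 ⟨le_rfl, hs₁⟩ 0)
  have hB0 : 0 ≤ B := by
    simpa using (norm_nonneg _).trans (hB 0 ⟨le_rfl, hs₁⟩ 0)
  refine ⟨A * B * (1 - r / ρ)⁻¹, fun s hs k => ?_⟩
  have h1 : ‖coeff k (F s * G s)‖ ≤ A * B * (((k : ℝ) + 1) * r ^ k) := by
    rw [coeff_mul]
    have h2 : ∀ p ∈ Finset.HasAntidiagonal.antidiagonal k,
        ‖coeff p.1 (F s) * coeff p.2 (G s)‖ ≤ A * B * r ^ k := by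
      intro p hp
      rw [norm_mul, ← Finset.HasAntidiagonal.mem_antidiagonal.1 hp, pow_add]
      calc _ ≤ (A * r ^ p.1) * (B * r ^ p.2) :=
            mul_le_mul (hA s hs _) (hB s hs _) (norm_nonneg _) (by positivity)
        _ = _ := by ring
    refine (norm_sum_le_of_le _ h2).trans ?_
    simp only [Finset.sum_const, Finset.Nat.card_antidiagonal, nsmul_eq_mul]
    push_cast
    exact le_of_eq (by ring)
  have h3 := succ_mul_pow_le (x := r / ρ) (by positivity) ((div_lt_one hρ0).2 hrρ) k
  calc _ ≤ A * B * (((k : ℝ) + 1) * r ^ k) := h1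
    _ = A * B * (((k : ℝ) + 1) * (r / ρ) ^ k) * ρ ^ k := by
        rw [div_pow]
        field_simp
    _ ≤ _ := by gcongr

theorem of_polynomial (hs₁ : 0 ≤ s₁) (N : ℕ) (B : ℝ)
    (h0 : ∀ s ∈ Set.Icc 0 s₁, ∀ k, N ≤ k → coeff k (F s) = 0)
    (hB : ∀ s ∈ Set.Icc 0 s₁, ∀ k, ‖coeff k (F s)‖ ≤ B) : GeometricBound s₁ F := by
  intro ρ hρ
  have hρ0 : 0 < ρ := hs₁.trans_lt hρ
  have hB0 : 0 ≤ B := (norm_nonneg _).trans (hB 0 ⟨le_rfl, hs₁⟩ 0)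
  refine ⟨∑ i ∈ Finset.range N, B * (ρ ^ i)⁻¹, fun s hs k => ?_⟩
  by_cases hk : N ≤ k
  · rw [h0 s hs k hk, norm_zero]
    positivity
  · have h1 : B * (ρ ^ k)⁻¹ ≤ ∑ i ∈ Finset.range N, B * (ρ ^ i)⁻¹ :=
      Finset.single_le_sum (f := fun i => B * (ρ ^ i)⁻¹) (fun i _ => by positivity)
        (Finset.mem_range.2 (not_le.1 hk))
    calc _ ≤ B := hB s hs k
      _ = B * (ρ ^ k)⁻¹ * ρ ^ k := by field_simp
      _ ≤ _ := by gcongr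

theorem const (hs₁ : 0 ≤ s₁) (a : ℂ) : GeometricBound s₁ fun _ => C a := by
  refine of_polynomial hs₁ 1 ‖a‖ (fun s _ k hk => ?_) fun s _ k => ?_
  · rw [coeff_C, if_neg (by omega)]
  · rw [coeff_C]
    split_ifs <;> simp

theorem shiftSeries (hs₁ : 0 ≤ s₁) : GeometricBound s₁ shiftSeries := by
  refine mul hs₁ ?_ ?_
  · refine add ?_ ?_
    · refine of_polynomial hs₁ 2 1 (fun s _ k hk => ?_) fun s _ k => ?_
      · rw [coeff_X, if_neg (by omega)]
      · rw [coeff_X]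
        split_ifs <;> simp
    · refine of_polynomial hs₁ 1 s₁ (fun s _ k hk => ?_) fun s hs k => ?_
      · rw [coeff_C, if_neg (by omega)]
      · rw [coeff_C]
        split_ifs
        · simpa [abs_of_nonneg hs.1] using hs.2
        · simpa using hs₁
  · intro ρ hρ
    refine ⟨1, fun s hs k => ?_⟩
    rw [invSeries, coeff_mk, one_mul, norm_pow, norm_neg, Complex.norm_real,
      Real.norm_of_nonneg hs.1]
    exact pow_le_pow_left₀ hs.1 (hs.2.trans hρ.le) k

theorem aeval (hs₁ : 0 ≤ s₁) (hF : GeometricBound s₁ F) (P : Polynomial ℂ) :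
    GeometricBound s₁ fun s => Polynomial.aeval (F s) P := by
  induction P using Polynomial.induction_on with
  | C a => simpa [PowerSeries.algebraMap_eq] using const hs₁ a
  | add p q hp hq => simpa using hp.add hq
  | monomial n a ih =>
    have h := ih.mul hs₁ hF
    simpa only [pow_succ, ← mul_assoc, map_mul, Polynomial.aeval_X] using h

end GeometricBound

theorem shiftCoeff_bound (P : Polynomial ℂ) {s₁ ρ : ℝ} (hs₁ : 0 ≤ s₁) (hρ : s₁ < ρ) :
    ∃ C, ∀ s ∈ Set.Icc 0 s₁, ∀ k, ‖shiftCoeff P s k‖ ≤ C * ρ ^ k :=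
  (GeometricBound.shiftSeries hs₁).aeval hs₁ P ρ hρ

/-! ### Values of the formal series in the disk -/

/-- The power series `F` converges absolutely at `z`, with sum `v`. -/
def EvaluatesTo (z : ℂ) (F : PowerSeries ℂ) (v : ℂ) : Prop :=
  (Summable fun k => ‖PowerSeries.coeff k F * z ^ k‖) ∧
    ∑' k, PowerSeries.coeff k F * z ^ k = v

namespace EvaluatesTo

open PowerSeries

variable {z v w : ℂ} {F G : PowerSeries ℂ}

theorem add (hF : EvaluatesTo z F v) (hG : EvaluatesTo z G w) : EvaluatesTo z (F + G) (v + w) := by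
  constructor
  · refine Summable.of_nonneg_of_le (fun k => norm_nonneg _) (fun k => ?_) (hF.1.add hG.1)
    rw [map_add, add_mul]
    exact norm_add_le _ _
  · rw [← hF.2, ← hG.2, ← hF.1.of_norm.tsum_add hG.1.of_norm]
    exact tsum_congr fun k => by rw [map_add, add_mul]

/-- The Cauchy product theorem, for which absolute convergence is part of the definition. -/
theorem mul (hF : EvaluatesTo z F v) (hG : EvaluatesTo z G w) : EvaluatesTo z (F * G) (v * w) := by
  have key : ∀ k, coeff k (F * G) * z ^ k = ∑ p ∈ Finset.HasAntidiagonal.antidiagonal k,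
      (coeff p.1 F * z ^ p.1) * (coeff p.2 G * z ^ p.2) := by
    intro k
    rw [coeff_mul, Finset.sum_mul]
    refine Finset.sum_congr rfl fun p hp => ?_
    rw [← Finset.HasAntidiagonal.mem_antidiagonal.1 hp, pow_add]
    ring
  constructor
  · simp only [key]
    exact summable_norm_sum_mul_antidiagonal_of_summable_norm
      (f := fun k => coeff k F * z ^ k) (g := fun k => coeff k G * z ^ k) hF.1 hG.1
  · rw [← hF.2, ← hG.2]
    exact (tsum_congr key).trans (tsum_mul_tsum_eq_tsum_sum_antidiagonal_of_summable_norm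
      (f := fun k => coeff k F * z ^ k) (g := fun k => coeff k G * z ^ k) hF.1 hG.1).symm

theorem const (z a : ℂ) : EvaluatesTo z (C a) a := by
  have h : ∀ k, k ≠ 0 → coeff k (C a) * z ^ k = 0 := fun k hk => by simp [coeff_C, hk]
  constructor
  · refine summable_of_ne_finset_zero (s := {0}) fun k hk => ?_
    rw [h k (by simpa using hk), norm_zero]
  · rw [tsum_eq_single 0 h]
    simp

theorem X (z : ℂ) : EvaluatesTo z X z := by
  have h : ∀ k, k ≠ 1 → coeff k (PowerSeries.X : PowerSeries ℂ) * z ^ k = 0 :=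
    fun k hk => by simp [coeff_X, hk]
  constructor
  · refine summable_of_ne_finset_zero (s := {1}) fun k hk => ?_
    rw [h k (by simpa using hk), norm_zero]
  · rw [tsum_eq_single 1 h]
    simp

theorem invSeries {s : ℝ} (hs : ‖(s : ℂ) * z‖ < 1) :
    EvaluatesTo z (invSeries s) (1 + s * z)⁻¹ := by
  have h : ∀ k, coeff k (_root_.invSeries s) * z ^ k = (-((s : ℂ) * z)) ^ k := by
    intro k
    rw [_root_.invSeries, coeff_mk, ← mul_pow, neg_mul]
  have hn : ‖-((s : ℂ) * z)‖ < 1 := by rwa [norm_neg]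
  constructor
  · simp only [h, norm_pow]
    exact summable_geometric_of_lt_one (norm_nonneg _) hn
  · simp only [h]
    rw [tsum_geometric_of_norm_lt_one hn, sub_neg_eq_add]

theorem shiftSeries {s : ℝ} (hs : ‖(s : ℂ) * z‖ < 1) :
    EvaluatesTo z (shiftSeries s) ((z + s) / (1 + s * z)) := by
  rw [div_eq_mul_inv]
  exact ((X z).add (const z s)).mul (invSeries hs)

theorem aeval (hF : EvaluatesTo z F v) (P : Polynomial ℂ) :
    EvaluatesTo z (Polynomial.aeval F P) (P.eval v) := by
  induction P using Polynomial.induction_on with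
  | C a => simpa [PowerSeries.algebraMap_eq] using const z a
  | add p q hp hq => simpa using hp.add hq
  | monomial n a ih =>
    have h := ih.mul hF
    simpa only [pow_succ, ← mul_assoc, map_mul, Polynomial.aeval_X, Polynomial.eval_mul,
      Polynomial.eval_X] using h

end EvaluatesTo

theorem tsum_shiftCoeff (P : Polynomial ℂ) {s : ℝ} {z : ℂ} (hs : ‖(s : ℂ) * z‖ < 1) :
    ∑' k, shiftCoeff P s k * z ^ k = P.eval ((z + s) / (1 + s * z)) :=
  ((EvaluatesTo.shiftSeries hs).aeval P).2

/-! ### Weights and summation by parts -/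

namespace WeightSequence

variable (W : WeightSequence)

theorem β_succ (k : ℕ) : W.β (k + 1) = W.β k * W.w (k + 1) :=
  Finset.prod_Icc_succ_top (by omega) _

/-- The ratio of consecutive terms tends to `r` because `w` tends to `1`. This makes geometrically
decaying coefficients square summable and kills the boundary term of the summation by parts. -/
theorem summable_succ_mul_β_sq_mul_pow {r : ℝ} (hr0 : 0 < r) (hr : r < 1) :
    Summable fun k : ℕ => ((k : ℝ) + 1) * W.β k ^ 2 * r ^ k := by
  have hpos : ∀ k : ℕ, 0 < ((k : ℝ) + 1) * W.β k ^ 2 * r ^ k := fun k => by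
    have := W.β_pos k
    positivity
  refine summable_of_ratio_test_tendsto_lt_one hr
    (Filter.Eventually.of_forall fun k => (hpos k).ne') ?_
  have h1 : Filter.Tendsto (fun k => W.w (k + 1)) Filter.atTop (𝓝 1) :=
    (Filter.tendsto_add_atTop_iff_nat 1).2 W.tendsto_one
  have h2 : Filter.Tendsto (fun k : ℕ => 1 + 1 / ((k : ℝ) + 1)) Filter.atTop (𝓝 (1 + 0)) :=
    tendsto_one_div_add_atTop_nhds_zero_nat.const_add 1
  have h3 := (h2.mul (h1.pow 2)).mul_const r
  rw [add_zero, one_pow, one_mul, one_mul] at h3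
  refine h3.congr fun k => ?_
  rw [Real.norm_of_nonneg (hpos _).le, Real.norm_of_nonneg (hpos _).le, β_succ]
  have := W.β_pos k
  push_cast
  field_simp
  ring

variable {W}

/-- The weights are almost symmetric for the vector field `(1 - z²) d/dz`. -/
theorem PolynomialGrowth.exists_defect_bound (hW : W.PolynomialGrowth) :
    ∃ K, 0 ≤ K ∧ ∀ k : ℕ,
      |W.β k ^ 2 * (k + 1) - W.β (k + 1) ^ 2 * k| ≤ K * (W.β k * W.β (k + 1)) := by
  obtain ⟨M, hM⟩ := hW
  have hM0 : 0 ≤ M := le_trans (by positivity) (hM 1 le_rfl)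
  have hinv : ∃ B, ∀ k : ℕ, (W.w (k + 1))⁻¹ ≤ B := by
    have h1 : Filter.Tendsto (fun k => (W.w (k + 1))⁻¹) Filter.atTop (𝓝 1⁻¹) :=
      ((Filter.tendsto_add_atTop_iff_nat 1).2 W.tendsto_one).inv₀ one_ne_zero
    obtain ⟨B, hB⟩ := h1.bddAbove_range
    exact ⟨B, fun k => hB ⟨k, rfl⟩⟩
  obtain ⟨B, hB⟩ := hinv
  have hB0 : 0 ≤ B := (inv_nonneg.2 (W.pos 1 le_rfl).le).trans (hB 0)
  -- With `x = w (k + 1)`, `k + 1 - x² k = 1 - 2 k (x - 1) - k (x - 1) * (x - 1)`, where `k |x - 1|`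
  -- and `|x - 1|` are at most `M`. The factor `B ≥ x⁻¹` turns `β k ^ 2` into `β k * β (k + 1)`.
  refine ⟨B * (1 + 2 * M + M ^ 2), by positivity, fun k => ?_⟩
  have hb := W.β_pos k
  have hw := W.pos (k + 1) (by omega)
  have hMk := hM (k + 1) (by omega)
  rw [β_succ]
  set x := W.w (k + 1) with hx
  have hkx : |(k : ℝ) * (x - 1)| ≤ M := by
    rw [abs_mul, Nat.abs_cast]
    refine le_trans ?_ hMk
    push_cast
    gcongr
    linarith
  have hx1 : |x - 1| ≤ M := by
    refine le_trans ?_ hMk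
    have h0 := abs_nonneg (x - 1)
    push_cast
    nlinarith [(Nat.cast_nonneg k : (0 : ℝ) ≤ k)]
  have h1 : |(k : ℝ) + 1 - x ^ 2 * k| ≤ 1 + 2 * M + M ^ 2 := by
    have : (k : ℝ) + 1 - x ^ 2 * k = 1 + (-(2 * (k * (x - 1))) - (k * (x - 1)) * (x - 1)) := by ring
    rw [this]
    have h2 : |(k * (x - 1)) * (x - 1)| ≤ M ^ 2 := by
      rw [abs_mul, sq]
      gcongr
    rw [abs_le] at h2 hkx ⊢
    constructor <;> linarith [h2.1, h2.2, hkx.1, hkx.2]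
  calc |W.β k ^ 2 * (k + 1) - (W.β k * x) ^ 2 * k|
      = W.β k ^ 2 * |(k : ℝ) + 1 - x ^ 2 * k| := by
        rw [← abs_of_pos (pow_pos hb 2), ← abs_mul, abs_of_pos (pow_pos hb 2)]
        congr 1
        ring
    _ ≤ W.β k ^ 2 * (1 + 2 * M + M ^ 2) := by gcongr
    _ = x⁻¹ * (1 + 2 * M + M ^ 2) * (W.β k * (W.β k * x)) := by
        field_simp
    _ ≤ _ := by
        gcongr
        exact hB k

end WeightSequence

/-- Summation by parts for the vector field `(1 - z²) d/dz`. -/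
theorem sum_re_conj_mul_flowCoeff (b : ℕ → ℝ) (a : ℕ → ℂ) (n : ℕ) :
    ∑ k ∈ Finset.range (n + 1), b k * (conj (a k) * flowCoeff a k).re =
      ∑ k ∈ Finset.range n, (b k * (k + 1) - b (k + 1) * k) * (conj (a k) * a (k + 1)).re +
        b n * (n + 1) * (conj (a n) * a (n + 1)).re := by
  induction n with
  | zero => simp [flowCoeff]
  | succ n ih =>
    rw [Finset.sum_range_succ, ih, Finset.sum_range_succ]
    have h : (conj (a (n + 1)) * flowCoeff a (n + 1)).re =
        (n + 2) * (conj (a (n + 1)) * a (n + 2)).re - n * (conj (a n) * a (n + 1)).re := by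
      simp [flowCoeff]
      ring
    rw [h]
    push_cast
    ring

/-- The arithmetic-geometric mean inequality splits each mixed product into two halves, and every
index receives at most two of them. The boundary term, which involves the index `n + 1`, is kept
apart because the truncated norm does not control it. -/
theorem abs_sum_re_conj_mul_flowCoeff_le {β : ℕ → ℝ} (hβ : ∀ k, 0 ≤ β k) {K : ℝ} (hK : 0 ≤ K)
    (h : ∀ k : ℕ, |β k ^ 2 * (k + 1) - β (k + 1) ^ 2 * k| ≤ K * (β k * β (k + 1)))
    (a : ℕ → ℂ) (n : ℕ) :
    |∑ k ∈ Finset.range (n + 1), β k ^ 2 * (conj (a k) * flowCoeff a k).re| ≤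
      K * ∑ k ∈ Finset.range (n + 1), β k ^ 2 * ‖a k‖ ^ 2 +
        β n ^ 2 * (n + 1) * (‖a n‖ * ‖a (n + 1)‖) := by
  rw [sum_re_conj_mul_flowCoeff (fun k => β k ^ 2)]
  have hre : ∀ k, |(conj (a k) * a (k + 1)).re| ≤ ‖a k‖ * ‖a (k + 1)‖ := by
    intro k
    refine (Complex.abs_re_le_norm _).trans_eq ?_
    rw [norm_mul, RCLike.norm_conj]
  refine (abs_add_le _ _).trans (add_le_add ?_ ?_)
  · have h1 : ∀ k ∈ Finset.range n,
        |(β k ^ 2 * (k + 1) - β (k + 1) ^ 2 * k) * (conj (a k) * a (k + 1)).re| ≤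
          K * ((β k ^ 2 * ‖a k‖ ^ 2) / 2 + (β (k + 1) ^ 2 * ‖a (k + 1)‖ ^ 2) / 2) := by
      intro k _
      rw [abs_mul]
      have hk := hβ k
      have hk1 := hβ (k + 1)
      calc _ ≤ (K * (β k * β (k + 1))) * (‖a k‖ * ‖a (k + 1)‖) :=
            mul_le_mul (h k) (hre k) (abs_nonneg _) (by positivity)
        _ = K * ((β k * ‖a k‖) * (β (k + 1) * ‖a (k + 1)‖)) := by ring
        _ ≤ _ := by
          gcongr
          nlinarith [sq_nonneg ((β k * ‖a k‖) - (β (k + 1) * ‖a (k + 1)‖))]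
    refine (Finset.abs_sum_le_sum_abs _ _).trans ((Finset.sum_le_sum h1).trans ?_)
    rw [← Finset.mul_sum, Finset.sum_add_distrib]
    gcongr
    have e1 := Finset.sum_range_succ (fun k => (β k ^ 2 * ‖a k‖ ^ 2) / 2) n
    have e2 := Finset.sum_range_succ' (fun k => (β k ^ 2 * ‖a k‖ ^ 2) / 2) n
    have e3 : ∑ k ∈ Finset.range (n + 1), β k ^ 2 * ‖a k‖ ^ 2 =
        2 * ∑ k ∈ Finset.range (n + 1), (β k ^ 2 * ‖a k‖ ^ 2) / 2 := by
      rw [Finset.mul_sum]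
      exact Finset.sum_congr rfl fun k _ => by ring
    have p1 : 0 ≤ β n ^ 2 * ‖a n‖ ^ 2 / 2 := by positivity
    have p2 : 0 ≤ β 0 ^ 2 * ‖a 0‖ ^ 2 / 2 := by positivity
    linarith
  · rw [abs_mul, abs_of_nonneg (by positivity)]
    gcongr
    exact hre n

/-! ### Gronwall's estimate and the maps `(z + s) / (1 + s z)` -/

namespace WeightSequence

variable {W : WeightSequence}

/-- Gronwall estimate for the partial sums of `‖P ((z + s₁) / (1 + s₁ z))‖²`. -/
theorem sum_shiftCoeff_le {K : ℝ} (hK : 0 ≤ K)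
    (h : ∀ k : ℕ,
      |W.β k ^ 2 * (k + 1) - W.β (k + 1) ^ 2 * k| ≤ K * (W.β k * W.β (k + 1)))
    (P : Polynomial ℂ) {s₁ : ℝ} (hs₁ : 0 ≤ s₁) (hs₁' : s₁ < 1) (m : ℕ) :
    ∑ k ∈ Finset.range (m + 1), W.β k ^ 2 * ‖shiftCoeff P s₁ k‖ ^ 2 ≤
      ‖WeightedHardySpace.ofPoly W P‖ ^ 2 * Real.exp (2 * K / (1 - s₁ ^ 2) * s₁) := by
  have hL : 0 < 1 - s₁ ^ 2 := by nlinarith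
  obtain ⟨ρ, hρ, hρ1⟩ := exists_between hs₁'
  have hρ0 : 0 < ρ := hs₁.trans_lt hρ
  obtain ⟨C, hC⟩ := shiftCoeff_bound P hs₁ hρ
  have hC0 : 0 ≤ C := by simpa using (norm_nonneg _).trans (hC 0 ⟨le_rfl, hs₁⟩ 0)
  set L := (1 - s₁ ^ 2)⁻¹ with hLdef
  have hL0 : 0 < L := inv_pos.2 hL
  -- Truncated norms are finite sums, so they may be differentiated termwise in `s`.
  set S : ℕ → ℝ → ℝ := fun n s =>
    ∑ k ∈ Finset.range (n + 1), W.β k ^ 2 * ‖shiftCoeff P s k‖ ^ 2 with hS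
  -- A bound for the boundary term, uniform in `s`: `L` dominates `(1 - s²)⁻¹`, and two consecutive
  -- coefficients have product at most `C² ρ^(2n+1)`.
  set ε : ℕ → ℝ := fun n => 2 * L * (C ^ 2 * ρ) * (((n : ℝ) + 1) * W.β n ^ 2 * (ρ ^ 2) ^ n)
    with hε
  have hεlim : Filter.Tendsto ε Filter.atTop (𝓝 0) := by
    have := (W.summable_succ_mul_β_sq_mul_pow (r := ρ ^ 2) (by positivity)
      (by nlinarith)).tendsto_atTop_zero.const_mul (2 * L * (C ^ 2 * ρ))
    rwa [mul_zero] at this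
  set S' : ℕ → ℝ → ℝ := fun n s => 2 * (1 - s ^ 2)⁻¹ * ∑ k ∈ Finset.range (n + 1),
    W.β k ^ 2 * (conj (shiftCoeff P s k) * flowCoeff (shiftCoeff P s) k).re with hS'
  have hpos : ∀ s ∈ Set.Icc 0 s₁, 0 < 1 - s ^ 2 := fun s hs => by
    nlinarith [hs.1, hs.2]
  have hderiv : ∀ n, ∀ s ∈ Set.Icc 0 s₁, HasDerivAt (S n) (S' n s) s := by
    intro n s hs
    have h1 : ∀ k, HasDerivAt (fun s => W.β k ^ 2 * ‖shiftCoeff P s k‖ ^ 2)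
        (W.β k ^ 2 * (2 * inner ℝ (shiftCoeff P s k)
          (((1 - s ^ 2)⁻¹ : ℝ) * flowCoeff (shiftCoeff P s) k))) s := fun k =>
      ((hasDerivAt_shiftCoeff P (hpos s hs).ne' k).norm_sq).const_mul _
    refine (HasDerivAt.fun_sum fun k _ => h1 k).congr_deriv ?_
    simp only [hS']
    rw [Finset.mul_sum]
    refine Finset.sum_congr rfl fun k _ => ?_
    rw [Complex.inner, mul_assoc (((1 - s ^ 2)⁻¹ : ℝ) : ℂ), Complex.re_ofReal_mul,
      mul_comm (flowCoeff _ _)]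
    ring
  have hbound : ∀ n, ∀ s ∈ Set.Icc 0 s₁, ‖S' n s‖ ≤ 2 * K / (1 - s₁ ^ 2) * ‖S n s‖ + ε n := by
    intro n s hs
    have hSn : 0 ≤ S n s := Finset.sum_nonneg fun k _ => by positivity
    have h1 := abs_sum_re_conj_mul_flowCoeff_le (fun k => (W.β_pos k).le) hK h (shiftCoeff P s) n
    have h2 : (1 - s ^ 2)⁻¹ ≤ L := by
      rw [hLdef]
      have := hpos s hs
      gcongr
      · exact hs.1
      · exact hs.2
    have h3 : ‖shiftCoeff P s n‖ * ‖shiftCoeff P s (n + 1)‖ ≤ C ^ 2 * ρ * (ρ ^ 2) ^ n := by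
      calc _ ≤ (C * ρ ^ n) * (C * ρ ^ (n + 1)) :=
            mul_le_mul (hC s hs n) (hC s hs (n + 1)) (norm_nonneg _) (by positivity)
        _ = _ := by ring
    have h4 : 0 ≤ (1 - s ^ 2)⁻¹ := (inv_pos.2 (hpos s hs)).le
    rw [Real.norm_of_nonneg hSn, hS', norm_mul, Real.norm_of_nonneg (by positivity),
      Real.norm_eq_abs]
    calc _ ≤ 2 * L * (K * S n s + W.β n ^ 2 * (n + 1) * (C ^ 2 * ρ * (ρ ^ 2) ^ n)) := by
          refine mul_le_mul (by gcongr) (h1.trans ?_) (abs_nonneg _) (by positivity)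
          gcongr
      _ = _ := by
          rw [hε, hLdef]
          ring
  have hgron : ∀ n, S n s₁ ≤
      gronwallBound (‖WeightedHardySpace.ofPoly W P‖ ^ 2) (2 * K / (1 - s₁ ^ 2)) (ε n) s₁ := by
    intro n
    have h0 : ‖S n 0‖ ≤ ‖WeightedHardySpace.ofPoly W P‖ ^ 2 := by
      rw [Real.norm_of_nonneg (Finset.sum_nonneg fun k _ => by positivity),
        WeightedHardySpace.norm_sq_eq]
      simp only [shiftCoeff_zero]
      exact (WeightedHardySpace.ofPoly W P).summable_norm.sum_le_tsum _ fun k _ => by positivity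
    have := norm_le_gronwallBound_of_norm_deriv_right_le
      (fun s hs => (hderiv n s hs).continuousAt.continuousWithinAt)
      (fun s hs => (hderiv n s (Set.Ico_subset_Icc_self hs)).hasDerivWithinAt) h0
      (fun s hs => hbound n s (Set.Ico_subset_Icc_self hs)) s₁ ⟨hs₁, le_rfl⟩
    rw [sub_zero] at this
    exact (le_abs_self _).trans this
  -- The Gronwall bound depends continuously on the inhomogeneity, so only the exponential survives
  -- as `n → ∞`.
  have hlim : Filter.Tendsto (fun n => gronwallBound (‖WeightedHardySpace.ofPoly W P‖ ^ 2)
      (2 * K / (1 - s₁ ^ 2)) (ε n) s₁) Filter.atTop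
      (𝓝 (‖WeightedHardySpace.ofPoly W P‖ ^ 2 * Real.exp (2 * K / (1 - s₁ ^ 2) * s₁))) := by
    rw [← gronwallBound_ε0]
    exact ((gronwallBound_continuous_ε _ _ _).tendsto 0).comp hεlim
  refine ge_of_tendsto hlim ?_
  filter_upwards [Filter.eventually_ge_atTop m] with n hn
  refine le_trans ?_ (hgron n)
  exact Finset.sum_le_sum_of_subset_of_nonneg
    (Finset.range_subset_range.2 (by omega)) fun k _ _ => by positivity

end WeightSequence

namespace WeightedHardySpace

variable {W : WeightSequence}

theorem summable_shiftCoeff (W : WeightSequence) (P : Polynomial ℂ) {s : ℝ} (hs : 0 ≤ s)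
    (hs' : s < 1) :
    Summable fun k => W.β k ^ 2 * ‖shiftCoeff P s k‖ ^ 2 := by
  obtain ⟨ρ, hρ, hρ1⟩ := exists_between hs'
  have hρ0 : 0 < ρ := hs.trans_lt hρ
  obtain ⟨C, hC⟩ := shiftCoeff_bound P hs hρ
  refine Summable.of_nonneg_of_le (fun k => by positivity) (fun k => ?_)
    ((W.summable_succ_mul_β_sq_mul_pow (r := ρ ^ 2) (by positivity) (by nlinarith)).mul_left
      (C ^ 2))
  have h1 := hC s ⟨hs, le_rfl⟩ k
  calc W.β k ^ 2 * ‖shiftCoeff P s k‖ ^ 2 ≤ W.β k ^ 2 * (C * ρ ^ k) ^ 2 := by gcongr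
    _ = C ^ 2 * (1 * W.β k ^ 2 * (ρ ^ 2) ^ k) := by ring
    _ ≤ _ := by
      gcongr
      linarith [(Nat.cast_nonneg k : (0 : ℝ) ≤ k)]

/-- `P ↦ P ((z + s) / (1 + s z))` on polynomials. -/
noncomputable def shiftPoly (W : WeightSequence) (s : ℝ) (hs : 0 ≤ s) (hs' : s < 1) :
    Polynomial ℂ →ₗ[ℂ] WeightedHardySpace W where
  toFun P := ⟨shiftCoeff P s, summable_shiftCoeff W P hs hs'⟩
  map_add' P Q := ext_coeff fun k => by
    change shiftCoeff (P + Q) s k = shiftCoeff P s k + shiftCoeff Q s k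
    simp [shiftCoeff]
  map_smul' c P := ext_coeff fun k => by
    change shiftCoeff (c • P) s k = c * shiftCoeff P s k
    simp [shiftCoeff]

/-- The Gronwall bound on the dense subspace of polynomials allows an extension by continuity. The
factor `2` in the exponent there disappears on taking square roots. -/
theorem exists_isCompositionOperator_shift (hW : W.PolynomialGrowth) :
    ∃ K, 0 ≤ K ∧ ∀ s : ℝ, 0 ≤ s → s < 1 →
      ∃ T, IsCompositionOperator W (fun z => (z + s) / (1 + s * z)) T ∧
        ‖T‖ ≤ Real.exp (K / (1 - s ^ 2) * s) := by
  obtain ⟨K, hK, h⟩ := hW.exists_defect_bound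
  refine ⟨K, hK, fun s hs hs' => ?_⟩
  have hbound : ∀ P, ‖shiftPoly W s hs hs' P‖ ≤
      Real.exp (K / (1 - s ^ 2) * s) * ‖ofPoly W P‖ := by
    intro P
    refine le_of_sq_le_sq ?_ (by positivity)
    have h1 : ‖shiftPoly W s hs hs' P‖ ^ 2 ≤
        ‖ofPoly W P‖ ^ 2 * Real.exp (2 * K / (1 - s ^ 2) * s) := by
      rw [norm_sq_eq]
      refine (summable_shiftCoeff W P hs hs').tsum_le_of_sum_range_le fun n => ?_
      refine le_trans ?_ (W.sum_shiftCoeff_le hK h P hs hs' n)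
      exact Finset.sum_le_sum_of_subset_of_nonneg
        (Finset.range_subset_range.2 (by omega)) fun k _ _ => by positivity
    refine h1.trans_eq ?_
    rw [mul_pow, ← Real.exp_nat_mul, mul_comm]
    congr 2
    push_cast
    ring
  refine ⟨(shiftPoly W s hs hs').extendOfNorm (ofPoly W), ?_, ?_⟩
  · intro f z hz
    have hz' : ‖z‖ < 1 := by simpa using hz
    have hsz : ‖(s : ℂ) * z‖ < 1 := by
      rw [norm_mul, Complex.norm_real, Real.norm_of_nonneg hs]
      nlinarith [norm_nonneg z]
    have hw : ‖(z + s) / (1 + s * z)‖ < 1 := by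
      have hne : (1 + s * z : ℂ) ≠ 0 := by
        intro h0
        have : (s : ℂ) * z = -1 := by linear_combination h0
        rw [this] at hsz
        simp at hsz
      rw [norm_div, div_lt_one (norm_pos_iff.2 hne)]
      refine lt_of_pow_lt_pow_left₀ 2 (norm_nonneg _) ?_
      rw [Complex.sq_norm, Complex.sq_norm]
      have h2 : Complex.normSq z < 1 := by
        rw [Complex.normSq_eq_norm_sq]
        nlinarith [norm_nonneg z]
      rw [Complex.normSq_apply] at h2 ⊢
      rw [Complex.normSq_apply]
      simp only [Complex.add_re, Complex.add_im, Complex.ofReal_re, Complex.ofReal_im,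
        Complex.one_re, Complex.one_im, Complex.mul_re, Complex.mul_im]
      -- `|1 + s z|² - |z + s|² = (1 - s²) (1 - |z|²)`.
      nlinarith [mul_pos (sub_pos.2 h2) (show 0 < 1 - s ^ 2 by nlinarith)]
    -- Both sides are continuous functionals of `f`, so it suffices to compare them on polynomials.
    refine (denseRange_ofPoly W).induction_on
      (p := fun f => evalL W z hz' ((shiftPoly W s hs hs').extendOfNorm (ofPoly W) f) =
        evalL W _ hw f) f ?_ ?_
    · exact isClosed_eq (by fun_prop) (by fun_prop)
    · intro P
      rw [LinearMap.extendOfNorm_eq (denseRange_ofPoly W) ⟨_, hbound⟩]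
      exact (tsum_shiftCoeff P hsz).trans (ofPoly_apply P _).symm
  · exact ContinuousLinearMap.opNorm_le_bound _ (Real.exp_pos _).le
      (LinearMap.norm_extendOfNorm_apply_le (denseRange_ofPoly W) _ hbound)

end WeightedHardySpace

/-! ### Composition operators of general disk automorphisms -/

namespace IsCompositionOperator

variable {W : WeightSequence} {φ ψ : ℂ → ℂ}
  {S T : WeightedHardySpace W →L[ℂ] WeightedHardySpace W}

theorem congr (hT : IsCompositionOperator W φ T)
    (h : Set.EqOn φ ψ (Metric.ball 0 1)) : IsCompositionOperator W ψ T :=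
  fun f z hz => (hT f z hz).trans (by rw [h hz])

theorem unique (hS : IsCompositionOperator W φ S) (hT : IsCompositionOperator W φ T) : S = T :=
  ContinuousLinearMap.ext fun f =>
    WeightedHardySpace.ext_apply fun z hz => (hS f z hz).trans (hT f z hz).symm

/-- Contravariant: the left factor of the product moves the point first. -/
theorem mul (hS : IsCompositionOperator W φ S) (hT : IsCompositionOperator W ψ T)
    (hφ : Set.MapsTo φ (Metric.ball 0 1) (Metric.ball 0 1)) :
    IsCompositionOperator W (ψ ∘ φ) (S * T) :=
  fun f z hz => (hS (T f) z hz).trans (hT f (φ z) (hφ hz))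

theorem one : IsCompositionOperator W id 1 := fun _ _ _ => rfl

end IsCompositionOperator

/-- Composition with a rotation is an isometry. -/
theorem exists_isCompositionOperator_rotation (W : WeightSequence) {c : ℂ} (hc : ‖c‖ = 1) :
    ∃ T, IsCompositionOperator W (fun z => c * z) T ∧ ‖T‖ ≤ 1 := by
  have hterm : ∀ (f : WeightedHardySpace W) (k : ℕ),
      W.β k ^ 2 * ‖c ^ k * f.coeff k‖ ^ 2 = W.β k ^ 2 * ‖f.coeff k‖ ^ 2 := by
    intro f k
    rw [norm_mul, norm_pow, hc, one_pow, one_mul]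
  let R : WeightedHardySpace W →ₗ[ℂ] WeightedHardySpace W :=
    { toFun := fun f => ⟨fun k => c ^ k * f.coeff k, by
        exact f.summable_norm.congr fun k => (hterm f k).symm⟩
      map_add' := fun f g => WeightedHardySpace.ext_coeff fun k => mul_add _ _ _
      map_smul' := fun a f => WeightedHardySpace.ext_coeff fun k => mul_left_comm _ _ _ }
  have hR : ∀ f, ‖R f‖ ≤ 1 * ‖f‖ := by
    intro f
    rw [one_mul]
    refine le_of_sq_le_sq ?_ (norm_nonneg _)
    rw [WeightedHardySpace.norm_sq_eq, WeightedHardySpace.norm_sq_eq]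
    exact (tsum_congr (hterm f)).le
  refine ⟨R.mkContinuous 1 hR, fun f z _ => ?_, R.mkContinuous_norm_le zero_le_one hR⟩
  refine tsum_congr fun k => ?_
  change c ^ k * f.coeff k * z ^ k = f.coeff k * (c * z) ^ k
  rw [mul_pow]
  ring

/-- The disk automorphism `z ↦ c (z + a) / (1 + conj a z)`, for `|c| = 1` and `|a| < 1`. -/
noncomputable def diskMap (c a z : ℂ) : ℂ := c * (z + a) / (1 + conj a * z)

theorem one_add_conj_mul_ne_zero {a z : ℂ} (ha : ‖a‖ < 1) (hz : ‖z‖ ≤ 1) :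
    1 + conj a * z ≠ 0 := by
  intro h0
  have h1 : ‖conj a * z‖ < 1 := by
    rw [norm_mul, RCLike.norm_conj]
    nlinarith [norm_nonneg z, norm_nonneg a]
  have h2 : conj a * z = -1 := by linear_combination h0
  rw [h2] at h1
  simp at h1

theorem norm_diskMap_lt_one {c a z : ℂ} (hc : ‖c‖ = 1) (ha : ‖a‖ < 1) (hz : ‖z‖ < 1) :
    ‖diskMap c a z‖ < 1 := by
  have hne := one_add_conj_mul_ne_zero ha hz.le
  rw [diskMap, norm_div, norm_mul, hc, one_mul, div_lt_one (norm_pos_iff.2 hne)]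
  refine lt_of_pow_lt_pow_left₀ 2 (norm_nonneg _) ?_
  have h1 : 0 < 1 - ‖a‖ ^ 2 := by nlinarith [norm_nonneg a]
  have h2 : 0 < 1 - ‖z‖ ^ 2 := by nlinarith [norm_nonneg z]
  have h3 := mul_pos h1 h2
  rw [Complex.sq_norm, Complex.sq_norm, Complex.normSq_apply, Complex.normSq_apply] at *
  simp only [Complex.add_re, Complex.add_im, Complex.one_re, Complex.one_im, Complex.mul_re,
    Complex.mul_im, Complex.conj_re, Complex.conj_im]
  nlinarith

theorem mapsTo_diskMap {c a : ℂ} (hc : ‖c‖ = 1) (ha : ‖a‖ < 1) :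
    Set.MapsTo (diskMap c a) (Metric.ball 0 1) (Metric.ball 0 1) := fun z hz => by
  rw [mem_ball_zero_iff] at hz ⊢
  exact norm_diskMap_lt_one hc ha hz

/-- Disk automorphisms induce bounded composition operators, of norm close to `1` if the
automorphism nearly fixes the origin. -/
theorem exists_isCompositionOperator_diskMap {W : WeightSequence} (hW : W.PolynomialGrowth) :
    ∃ K, 0 ≤ K ∧ ∀ c a : ℂ, ‖c‖ = 1 → ‖a‖ < 1 →
      ∃ T, IsCompositionOperator W (diskMap c a) T ∧
        ‖T‖ ≤ Real.exp (K / (1 - ‖a‖ ^ 2) * ‖a‖) := by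
  obtain ⟨K, hK, h⟩ := WeightedHardySpace.exists_isCompositionOperator_shift hW
  refine ⟨K, hK, fun c a hc ha => ?_⟩
  obtain ⟨T, hT, hTn⟩ := h ‖a‖ (norm_nonneg a) ha
  -- The map factors as the rotation by `d⁻¹`, the real shift by `‖a‖`, and the rotation by `c * d`;
  -- the rotations do not change the norm bound.
  obtain ⟨d, hd, had⟩ : ∃ d : ℂ, ‖d‖ = 1 ∧ a = ‖a‖ * d := by
    refine ⟨Complex.exp (a.arg * Complex.I), Complex.norm_exp_ofReal_mul_I _, ?_⟩
    exact (Complex.norm_mul_exp_arg_mul_I a).symm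
  have hd0 : d ≠ 0 := by
    rintro rfl
    simp at hd
  have hconj : conj d = d⁻¹ := (Complex.inv_eq_conj hd).symm
  obtain ⟨R₁, hR₁, hR₁n⟩ := exists_isCompositionOperator_rotation W
    (c := d⁻¹) (by rw [norm_inv, hd, inv_one])
  obtain ⟨R₂, hR₂, hR₂n⟩ := exists_isCompositionOperator_rotation W
    (c := c * d) (by rw [norm_mul, hc, hd, one_mul])
  have hmaps₁ : Set.MapsTo (fun z => d⁻¹ * z) (Metric.ball (0 : ℂ) 1) (Metric.ball 0 1) := by
    intro z hz
    rw [mem_ball_zero_iff] at hz ⊢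
    rwa [norm_mul, norm_inv, hd, inv_one, one_mul]
  have hmaps₂ : Set.MapsTo (fun z : ℂ => (z + ‖a‖) / (1 + ‖a‖ * z))
      (Metric.ball (0 : ℂ) 1) (Metric.ball 0 1) := by
    intro z hz
    have := mapsTo_diskMap (c := 1) (a := ‖a‖) (by simp) (by simpa using ha) hz
    simpa [diskMap] using this
  refine ⟨R₁ * (T * R₂), ((hR₁.mul (hT.mul hR₂ hmaps₂) hmaps₁).congr fun z hz => ?_), ?_⟩
  · have hc' : conj a = ‖a‖ * d⁻¹ := by
      conv_lhs => rw [had]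
      rw [map_mul, hconj, Complex.conj_ofReal]
    have hd' : d⁻¹ * z + ‖a‖ = d⁻¹ * (z + a) := by
      conv_rhs => rw [had]
      field_simp
    simp only [Function.comp_apply, diskMap]
    rw [hd', hc', mul_assoc (‖a‖ : ℂ), mul_div_assoc', mul_assoc c, ← mul_assoc d,
      mul_inv_cancel₀ hd0, one_mul]
  · calc ‖R₁ * (T * R₂)‖ ≤ ‖R₁‖ * (‖T‖ * ‖R₂‖) :=
          (norm_mul_le _ _).trans (by gcongr; exact norm_mul_le _ _)
      _ ≤ 1 * (Real.exp (K / (1 - ‖a‖ ^ 2) * ‖a‖) * 1) := by gcongr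
      _ = _ := by ring

/-! ### Parabolic and hyperbolic maps in the half-plane coordinate -/

/-- The parabolic automorphism which is the translation by `i τ` in the coordinate
`(1 + z) / (1 - z)`. -/
noncomputable def parabolicMap (τ : ℝ) : ℂ → ℂ :=
  diskMap ((2 - Complex.I * τ) / (2 + Complex.I * τ)) (Complex.I * τ / (2 - Complex.I * τ))

/-- The inverse of the coordinate `(1 + z) / (1 - z)`. -/
noncomputable def cayleyInv (u : ℂ) : ℂ := (u - 1) / (u + 1)

/-- The real part of `(1 + z) / (1 - z)` is `(1 - |z|²) / |1 - z|²`. In this coordinate the maps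
below are translations and dilations, so their relations become evident. -/
theorem exists_cayleyInv_eq {z : ℂ} (hz : z ∈ Metric.ball (0 : ℂ) 1) :
    ∃ u : ℂ, 0 < u.re ∧ cayleyInv u = z := by
  rw [mem_ball_zero_iff] at hz
  have hne : 1 - z ≠ 0 := by
    intro h
    rw [← sub_eq_zero.1 h] at hz
    simp at hz
  refine ⟨(1 + z) / (1 - z), ?_, ?_⟩
  · have h2 : 0 < 1 - ‖z‖ ^ 2 := by nlinarith [norm_nonneg z]
    have h3 : ((1 + z) / (1 - z)).re = (1 - ‖z‖ ^ 2) / Complex.normSq (1 - z) := by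
      rw [Complex.div_re, ← add_div, Complex.sq_norm, Complex.normSq_apply z]
      simp
      ring
    rw [h3]
    exact div_pos h2 (Complex.normSq_pos.2 hne)
  · rw [cayleyInv]
    field_simp
    ring

theorem ne_zero_of_re_pos {u : ℂ} (hu : 0 < u.re) : u ≠ 0 := by
  rintro rfl
  simp at hu

theorem two_add_I_mul_ne_zero (τ : ℝ) : 2 + Complex.I * τ ≠ 0 := ne_zero_of_re_pos (by simp)

theorem two_sub_I_mul_ne_zero (τ : ℝ) : 2 - Complex.I * τ ≠ 0 := ne_zero_of_re_pos (by simp)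

theorem conj_two_sub_I_mul (τ : ℝ) : conj (2 - Complex.I * τ) = 2 + Complex.I * τ := by
  apply Complex.ext <;> simp

theorem norm_two_sub_I_mul (τ : ℝ) : ‖2 - Complex.I * τ‖ = ‖2 + Complex.I * τ‖ := by
  rw [← conj_two_sub_I_mul, RCLike.norm_conj]

theorem norm_parabolic_multiplier (τ : ℝ) :
    ‖(2 - Complex.I * τ) / (2 + Complex.I * τ)‖ = 1 := by
  rw [norm_div, norm_two_sub_I_mul, div_self (norm_ne_zero_iff.2 (two_add_I_mul_ne_zero τ))]

theorem norm_parabolic_shift_lt_one (τ : ℝ) :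
    ‖Complex.I * τ / (2 - Complex.I * τ)‖ < 1 := by
  rw [norm_div, div_lt_one (norm_pos_iff.2 (two_sub_I_mul_ne_zero τ))]
  refine lt_of_pow_lt_pow_left₀ 2 (norm_nonneg _) ?_
  rw [Complex.sq_norm, Complex.sq_norm, Complex.normSq_apply, Complex.normSq_apply]
  simp

theorem mapsTo_parabolicMap (τ : ℝ) :
    Set.MapsTo (parabolicMap τ) (Metric.ball 0 1) (Metric.ball 0 1) :=
  mapsTo_diskMap (norm_parabolic_multiplier τ) (norm_parabolic_shift_lt_one τ)

theorem parabolicMap_eq (τ : ℝ) (z : ℂ) : parabolicMap τ z =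
    ((2 - Complex.I * τ) * z + Complex.I * τ) / ((2 + Complex.I * τ) - Complex.I * τ * z) := by
  have h1 := two_add_I_mul_ne_zero τ
  have h2 := two_sub_I_mul_ne_zero τ
  rw [parabolicMap, diskMap, map_div₀, conj_two_sub_I_mul, map_mul, Complex.conj_I,
    Complex.conj_ofReal]
  have e1 : (2 - Complex.I * τ) / (2 + Complex.I * τ) * (z + Complex.I * τ / (2 - Complex.I * τ)) =
      ((2 - Complex.I * τ) * z + Complex.I * τ) / (2 + Complex.I * τ) := by
    field_simp
  have e2 : 1 + -Complex.I * τ / (2 + Complex.I * τ) * z =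
      ((2 + Complex.I * τ) - Complex.I * τ * z) / (2 + Complex.I * τ) := by
    field_simp
    ring
  rw [e1, e2, div_div_div_cancel_right₀ h1]

theorem parabolicMap_cayleyInv (τ : ℝ) {u : ℂ} (hu : 0 < u.re) :
    parabolicMap τ (cayleyInv u) = cayleyInv (u + Complex.I * τ) := by
  have h1 : u + 1 ≠ 0 := ne_zero_of_re_pos (by simp; linarith)
  have h2 : u + Complex.I * τ + 1 ≠ 0 := ne_zero_of_re_pos (by simp; linarith)
  rw [parabolicMap_eq, cayleyInv, cayleyInv]
  have e1 : (2 - Complex.I * τ) * ((u - 1) / (u + 1)) + Complex.I * τ =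
      2 * (u + Complex.I * τ - 1) / (u + 1) := by
    field_simp
    ring
  have e2 : (2 + Complex.I * τ) - Complex.I * τ * ((u - 1) / (u + 1)) =
      2 * (u + Complex.I * τ + 1) / (u + 1) := by
    field_simp
    ring
  rw [e1, e2, div_div_div_cancel_right₀ h1, mul_div_mul_left _ _ two_ne_zero]

/-- The origin has coordinate `1`, which the dilation sends to `ρ`; the shift `(ρ - 1) / (ρ + 1)` is
the disk point with coordinate `ρ`. -/
theorem diskMap_cayleyInv {ρ : ℝ} (hρ : 0 < ρ) {u : ℂ} (hu : 0 < u.re) :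
    diskMap 1 (((ρ - 1) / (ρ + 1) : ℝ) : ℂ) (cayleyInv u) = cayleyInv (ρ * u) := by
  have h1 : u + 1 ≠ 0 := ne_zero_of_re_pos (by simp; linarith)
  have h2 : ρ * u + 1 ≠ 0 := ne_zero_of_re_pos (by simp; positivity)
  have h3 : (ρ : ℂ) + 1 ≠ 0 := ne_zero_of_re_pos (by simp; linarith)
  rw [diskMap, Complex.conj_ofReal, cayleyInv, cayleyInv]
  push_cast
  have e1 : 1 * ((u - 1) / (u + 1) + ((ρ : ℂ) - 1) / (ρ + 1)) =
      2 * (ρ * u - 1) / ((u + 1) * (ρ + 1)) := by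
    field_simp
    ring
  have e2 : 1 + ((ρ : ℂ) - 1) / (ρ + 1) * ((u - 1) / (u + 1)) =
      2 * (ρ * u + 1) / ((u + 1) * (ρ + 1)) := by
    field_simp
    ring
  rw [e1, e2, div_div_div_cancel_right₀ (mul_ne_zero h1 h3), mul_div_mul_left _ _ two_ne_zero]

theorem norm_dilation_shift_lt_one {ρ : ℝ} (hρ : 0 < ρ) :
    ‖(((ρ - 1) / (ρ + 1) : ℝ) : ℂ)‖ < 1 := by
  rw [Complex.norm_real, Real.norm_eq_abs, abs_div, abs_of_pos (by linarith : 0 < ρ + 1),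
    div_lt_one (by linarith), abs_lt]
  constructor <;> linarith

theorem parabolicMap_add (σ τ : ℝ) :
    Set.EqOn (parabolicMap σ ∘ parabolicMap τ) (parabolicMap (σ + τ)) (Metric.ball 0 1) := by
  intro z hz
  obtain ⟨u, hu, rfl⟩ := exists_cayleyInv_eq hz
  rw [Function.comp_apply, parabolicMap_cayleyInv τ hu, parabolicMap_cayleyInv σ (by simpa),
    parabolicMap_cayleyInv _ hu]
  congr 1
  push_cast
  ring

theorem parabolicMap_zero : parabolicMap 0 = id := by
  ext z
  rw [parabolicMap_eq]
  simp

/-- In the half-plane, `ρ⁻¹ (ρ u + i τ) = u + i τ / ρ`: a translation is conjugate to arbitrarily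
short ones. -/
theorem diskMap_comp_parabolicMap_comp_diskMap {ρ : ℝ} (hρ : 0 < ρ) (τ : ℝ) :
    Set.EqOn (diskMap 1 (((ρ⁻¹ - 1) / (ρ⁻¹ + 1) : ℝ) : ℂ) ∘ parabolicMap τ ∘
      diskMap 1 (((ρ - 1) / (ρ + 1) : ℝ) : ℂ)) (parabolicMap (ρ⁻¹ * τ)) (Metric.ball 0 1) := by
  intro z hz
  obtain ⟨u, hu, rfl⟩ := exists_cayleyInv_eq hz
  have hu' : 0 < ((ρ : ℂ) * u).re := by
    rw [Complex.re_ofReal_mul]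
    positivity
  rw [Function.comp_apply, Function.comp_apply, diskMap_cayleyInv hρ hu,
    parabolicMap_cayleyInv τ hu', diskMap_cayleyInv (inv_pos.2 hρ) (by simpa using hu'),
    parabolicMap_cayleyInv _ hu]
  have : (ρ : ℂ) ≠ 0 := by exact_mod_cast hρ.ne'
  congr 1
  push_cast
  field_simp

theorem diskMap_comp_diskMap_dilation {ρ : ℝ} (hρ : 0 < ρ) :
    Set.EqOn (diskMap 1 (((ρ⁻¹ - 1) / (ρ⁻¹ + 1) : ℝ) : ℂ) ∘
      diskMap 1 (((ρ - 1) / (ρ + 1) : ℝ) : ℂ)) id (Metric.ball 0 1) := by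
  have h := diskMap_comp_parabolicMap_comp_diskMap hρ 0
  rwa [mul_zero, parabolicMap_zero, Function.id_comp] at h

/-! ### Subexponential growth of the powers -/

namespace IsCompositionOperator

variable {W : WeightSequence}

theorem exists_parabolicMap (hW : W.PolynomialGrowth) (τ : ℝ) :
    ∃ T, IsCompositionOperator W (parabolicMap τ) T := by
  obtain ⟨K, -, h⟩ := exists_isCompositionOperator_diskMap hW
  obtain ⟨T, hT, -⟩ := h _ _ (norm_parabolic_multiplier τ) (norm_parabolic_shift_lt_one τ)
  exact ⟨T, hT⟩

/-- The shift `iτ / (2 - iτ)` tends to `0` with `τ`, so the exponential norm bound tends to `1`. -/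
theorem eventually_exists_parabolicMap_norm_le (hW : W.PolynomialGrowth) {ε : ℝ} (hε : 0 < ε) :
    ∀ᶠ τ : ℝ in 𝓝 0, ∃ T, IsCompositionOperator W (parabolicMap τ) T ∧ ‖T‖ ≤ 1 + ε := by
  obtain ⟨K, -, h⟩ := exists_isCompositionOperator_diskMap hW
  have hcont : ContinuousAt (fun τ : ℝ =>
      Real.exp (K / (1 - ‖Complex.I * τ / (2 - Complex.I * τ)‖ ^ 2) *
        ‖Complex.I * τ / (2 - Complex.I * τ)‖)) 0 := by
    have h0 : ContinuousAt (fun τ : ℝ => ‖Complex.I * τ / (2 - Complex.I * τ)‖) 0 :=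
      Continuous.continuousAt (Continuous.norm (Continuous.div (by fun_prop) (by fun_prop)
        two_sub_I_mul_ne_zero))
    refine ContinuousAt.rexp (ContinuousAt.mul (ContinuousAt.div continuousAt_const ?_ ?_) h0)
    · fun_prop
    · simp
  have hev := hcont.eventually_lt (continuousAt_const (y := 1 + ε)) (by simpa using hε)
  filter_upwards [hev] with τ hτ
  obtain ⟨T, hT, hTn⟩ := h _ _ (norm_parabolic_multiplier τ) (norm_parabolic_shift_lt_one τ)
  exact ⟨T, hT, hTn.trans hτ.le⟩

theorem parabolicMap_pow {τ : ℝ} {T : WeightedHardySpace W →L[ℂ] WeightedHardySpace W}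
    (hT : IsCompositionOperator W (parabolicMap τ) T) (n : ℕ) :
    IsCompositionOperator W (parabolicMap (n * τ)) (T ^ n) := by
  induction n with
  | zero => simpa [parabolicMap_zero] using one
  | succ n ih =>
    rw [pow_succ']
    refine (hT.mul ih (mapsTo_parabolicMap τ)).congr ?_
    convert! parabolicMap_add (n * τ) τ using 2
    push_cast
    ring

/-- The powers of a parabolic composition operator grow subexponentially: it is similar to
operators of norm arbitrarily close to `1`. -/
theorem parabolicMap_pow_bound (hW : W.PolynomialGrowth) {τ : ℝ}
    {T : WeightedHardySpace W →L[ℂ] WeightedHardySpace W}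
    (hT : IsCompositionOperator W (parabolicMap τ) T) {ε : ℝ} (hε : 0 < ε) :
    ∃ C, ∀ n : ℕ, ‖T ^ n‖ ≤ C * (1 + ε) ^ n := by
  have h1 : Filter.Tendsto (fun r : ℝ => r * τ) (𝓝[>] 0) (𝓝 0) := by
    have : Continuous fun r : ℝ => r * τ := by fun_prop
    simpa using (this.tendsto 0).mono_left (nhdsWithin_le_nhds (s := Set.Ioi 0))
  obtain ⟨r, ⟨S, hS, hSn⟩, hr⟩ :=
    ((h1.eventually (eventually_exists_parabolicMap_norm_le hW hε)).and
      self_mem_nhdsWithin).exists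
  obtain ⟨K, -, hK⟩ := exists_isCompositionOperator_diskMap hW
  have hr0 : 0 < r := hr
  have hr' : 0 < r⁻¹ := inv_pos.2 hr0
  obtain ⟨D, hD, -⟩ := hK 1 _ norm_one (norm_dilation_shift_lt_one hr0)
  obtain ⟨E, hE, -⟩ := hK 1 _ norm_one (norm_dilation_shift_lt_one hr')
  have mD := mapsTo_diskMap norm_one (norm_dilation_shift_lt_one hr0)
  have mE := mapsTo_diskMap norm_one (norm_dilation_shift_lt_one hr')
  have hDE : D * E = 1 := unique ((hD.mul hE mD).congr (diskMap_comp_diskMap_dilation hr0)) one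
  have hED : E * D = 1 := by
    have h2 := diskMap_comp_diskMap_dilation hr'
    rw [inv_inv] at h2
    exact unique ((hE.mul hD mE).congr h2) one
  have hST : S = E * T * D := by
    have h3 := diskMap_comp_parabolicMap_comp_diskMap hr' τ
    rw [inv_inv] at h3
    rw [mul_assoc]
    exact unique hS ((hE.mul (hT.mul hD (mapsTo_parabolicMap τ)) mE).congr h3)
  -- The norms of `D` and `E` depend on `ε` but not on `n`, and enter each power only once.
  have hpow : ∀ n : ℕ, T ^ n = D * S ^ n * E := by
    intro n
    have h4 : SemiconjBy D S T := by
      rw [SemiconjBy, hST, ← mul_assoc, ← mul_assoc, hDE, one_mul]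
    rw [(h4.pow_right n).eq, mul_assoc, hDE, mul_one]
  refine ⟨‖D‖ * ‖E‖, fun n => ?_⟩
  have h5 : ‖S ^ n‖ ≤ (1 + ε) ^ n := by
    rcases n.eq_zero_or_pos with rfl | hn
    · rw [pow_zero, pow_zero]
      exact ContinuousLinearMap.norm_id_le
    · exact (norm_pow_le' S hn).trans (pow_le_pow_left₀ (norm_nonneg _) hSn n)
  calc ‖T ^ n‖ ≤ ‖D‖ * ‖S ^ n‖ * ‖E‖ := by
        rw [hpow]
        exact (norm_mul_le _ _).trans (by gcongr; exact norm_mul_le _ _)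
    _ ≤ ‖D‖ * (1 + ε) ^ n * ‖E‖ := by gcongr
    _ = _ := by ring

end IsCompositionOperator

/-! ### Resolvent expansions on the unit circle -/

section BanachAlgebra

variable {A : Type*} [NormedRing A] [NormedAlgebra ℂ A] [CompleteSpace A]

/-- If `1 < q < |μ|`, then `μ ^ n` lies in the spectrum of `a ^ n`, so `|μ| ^ n` would be at most a
constant times `q ^ n`. -/
theorem spectrum_subset_closedBall_of_pow_bound {a : A}
    (h : ∀ ε > 0, ∃ C, ∀ n : ℕ, ‖a ^ n‖ ≤ C * (1 + ε) ^ n) :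
    spectrum ℂ a ⊆ Metric.closedBall 0 1 := by
  intro μ hμ
  rw [mem_closedBall_zero_iff]
  by_contra! hlt
  obtain ⟨q, hq1, hq⟩ := exists_between hlt
  obtain ⟨C, hC⟩ := h (q - 1) (by linarith)
  have hq0 : 0 < q := by linarith
  have hbound : ∀ n : ℕ, (‖μ‖ / q) ^ n ≤ C * ‖(1 : A)‖ := by
    intro n
    have h1 := spectrum.norm_le_norm_mul_of_mem (spectrum.pow_mem_pow a n hμ)
    have h2 := hC n
    rw [add_sub_cancel] at h2
    rw [norm_pow] at h1
    rw [div_pow, div_le_iff₀ (by positivity)]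
    calc ‖μ‖ ^ n ≤ ‖a ^ n‖ * ‖(1 : A)‖ := h1
      _ ≤ C * q ^ n * ‖(1 : A)‖ := by gcongr
      _ = _ := by ring
  obtain ⟨n, hn⟩ := pow_unbounded_of_one_lt (C * ‖(1 : A)‖) ((one_lt_div hq0).2 hq)
  exact absurd (hbound n) (not_le.2 hn)

theorem summable_smul_pow_of_pow_bound {a : A}
    (h : ∀ ε > 0, ∃ C, ∀ n : ℕ, ‖a ^ n‖ ≤ C * (1 + ε) ^ n) {c : ℂ} (hc : ‖c‖ < 1) :
    Summable fun n : ℕ => (c • a) ^ n := by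
  have hε : 0 < (1 - ‖c‖) / 2 := by linarith
  obtain ⟨C, hC⟩ := h _ hε
  have hr : ‖c‖ * (1 + (1 - ‖c‖) / 2) < 1 := by nlinarith [norm_nonneg c]
  have hr0 : 0 ≤ ‖c‖ * (1 + (1 - ‖c‖) / 2) := by
    have := norm_nonneg c
    positivity
  refine Summable.of_norm_bounded ((summable_geometric_of_lt_one hr0 hr).mul_left C) fun n => ?_
  rw [smul_pow, norm_smul, norm_pow, mul_pow]
  calc ‖c‖ ^ n * ‖a ^ n‖ ≤ ‖c‖ ^ n * (C * (1 + (1 - ‖c‖) / 2) ^ n) := by gcongr; exact hC n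
    _ = _ := by ring

theorem tsum_smul_pow_eq_inverse {a : A}
    (h : ∀ ε > 0, ∃ C, ∀ n : ℕ, ‖a ^ n‖ ≤ C * (1 + ε) ^ n) {c : ℂ} (hc : ‖c‖ < 1) :
    ∑' n : ℕ, (c • a) ^ n = Ring.inverse (1 - c • a) := by
  have hs := summable_smul_pow_of_pow_bound h hc
  let u : Aˣ := ⟨1 - c • a, ∑' n : ℕ, (c • a) ^ n, hs.one_sub_mul_tsum_pow, hs.tsum_pow_mul_one_sub⟩
  exact (Ring.inverse_unit u).symm

/-- Abel summation of the Neumann series at a boundary point of the disk of convergence. -/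
theorem tsum_eq_apply_inverse {a : A}
    (h : ∀ ε > 0, ∃ C, ∀ n : ℕ, ‖a ^ n‖ ≤ C * (1 + ε) ^ n) {c : ℂ} (hc : ‖c‖ = 1)
    (hu : IsUnit (1 - c • a)) (L : A →L[ℂ] ℂ) (hL : Summable fun n : ℕ => ‖L (a ^ n)‖) :
    ∑' n : ℕ, c ^ n * L (a ^ n) = L (Ring.inverse (1 - c • a)) := by
  have hr : ∀ᶠ r : ℝ in 𝓝[<] 1, r ∈ Set.Ioo (0 : ℝ) 1 := Ioo_mem_nhdsLT one_pos
  -- Radial limit `r → 1`: the series converges by domination, and the inverse by its continuity at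
  -- a unit.
  have hlim1 : Filter.Tendsto (fun r : ℝ => ∑' n : ℕ, ((r : ℂ) * c) ^ n * L (a ^ n)) (𝓝[<] 1)
      (𝓝 (∑' n : ℕ, c ^ n * L (a ^ n))) := by
    refine tendsto_tsum_of_dominated_convergence hL (fun n => ?_) ?_
    · have : Continuous fun r : ℝ => ((r : ℂ) * c) ^ n * L (a ^ n) := by fun_prop
      have h2 := (this.tendsto 1).mono_left (nhdsWithin_le_nhds (s := Set.Iio 1))
      simpa using h2
    · filter_upwards [hr] with r hr n
      rw [norm_mul, norm_pow, norm_mul, hc, mul_one, Complex.norm_real,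
        Real.norm_of_nonneg hr.1.le]
      exact mul_le_of_le_one_left (norm_nonneg _) (pow_le_one₀ hr.1.le hr.2.le)
  have hlim2 : Filter.Tendsto (fun r : ℝ => L (Ring.inverse (1 - ((r : ℂ) * c) • a))) (𝓝[<] 1)
      (𝓝 (L (Ring.inverse (1 - c • a)))) := by
    refine (L.continuous.tendsto _).comp ?_
    obtain ⟨u, hu⟩ := hu
    have h1 : Filter.Tendsto (fun r : ℝ => 1 - ((r : ℂ) * c) • a) (𝓝[<] 1) (𝓝 (u : A)) := by
      have : Continuous fun r : ℝ => 1 - ((r : ℂ) * c) • a := by fun_prop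
      have h2 := (this.tendsto 1).mono_left (nhdsWithin_le_nhds (s := Set.Iio 1))
      rw [hu]
      simpa using h2
    rw [← hu]
    exact (NormedRing.inverse_continuousAt u).tendsto.comp h1
  refine tendsto_nhds_unique hlim1 (hlim2.congr' ?_)
  filter_upwards [hr] with r hr
  have hrc : ‖(r : ℂ) * c‖ < 1 := by
    rw [norm_mul, hc, mul_one, Complex.norm_real, Real.norm_of_nonneg hr.1.le]
    exact hr.2
  rw [← tsum_smul_pow_eq_inverse h hrc, L.map_tsum (summable_smul_pow_of_pow_bound h hrc)]
  refine tsum_congr fun n => ?_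
  rw [smul_pow, map_smul, smul_eq_mul]

/-- If all powers of `u` grow subexponentially, then the two-sided orbit sums of `u`
vanish at the points of the unit circle outside the spectrum. -/
theorem tsum_orbit_eq_zero_of_notMem_spectrum {u : Aˣ}
    (h : ∀ ε > 0, ∃ C, ∀ n : ℕ, ‖(u : A) ^ n‖ ≤ C * (1 + ε) ^ n)
    (h' : ∀ ε > 0, ∃ C, ∀ n : ℕ, ‖((u⁻¹ : Aˣ) : A) ^ n‖ ≤ C * (1 + ε) ^ n)
    {μ : ℂ} (hμ : ‖μ‖ = 1) (hμu : μ ∉ spectrum ℂ (u : A)) (L : A →L[ℂ] ℂ)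
    (hL : Summable fun n : ℕ => ‖L ((u : A) ^ n)‖)
    (hL' : Summable fun n : ℕ => ‖L (((u⁻¹ : Aˣ) : A) ^ n)‖) :
    ∑' n : ℕ, μ⁻¹ ^ n * L ((u : A) ^ n) +
      ∑' n : ℕ, μ ^ (n + 1) * L (((u⁻¹ : Aˣ) : A) ^ (n + 1)) = 0 := by
  have hμ0 : μ ≠ 0 := by
    rintro rfl
    simp at hμ
  rw [spectrum.notMem_iff, Algebra.algebraMap_eq_smul_one] at hμu
  obtain ⟨v, hv⟩ := hμu
  have e1 : 1 - μ⁻¹ • (u : A) = μ⁻¹ • (v : A) := by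
    rw [hv, smul_sub, smul_smul, inv_mul_cancel₀ hμ0, one_smul]
  have e2 : 1 - μ • ((u⁻¹ : Aˣ) : A) = -(((u⁻¹ : Aˣ) : A) * (v : A)) := by
    rw [hv, mul_sub, mul_smul_comm, mul_one, Units.inv_mul]
    abel
  let w₁ : Aˣ := ⟨1 - μ⁻¹ • (u : A), μ • ((v⁻¹ : Aˣ) : A), by
    rw [e1, smul_mul_smul_comm, inv_mul_cancel₀ hμ0, Units.mul_inv, one_smul], by
    rw [e1, smul_mul_smul_comm, mul_inv_cancel₀ hμ0, Units.inv_mul, one_smul]⟩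
  let w₂ : Aˣ := ⟨1 - μ • ((u⁻¹ : Aˣ) : A), -(((v⁻¹ : Aˣ) : A) * u), by
    rw [e2, neg_mul_neg, mul_assoc, Units.mul_inv_cancel_left, Units.inv_mul], by
    rw [e2, neg_mul_neg, mul_assoc, Units.mul_inv_cancel_left, Units.inv_mul]⟩
  have s1 := tsum_eq_apply_inverse h (c := μ⁻¹) (by rw [norm_inv, hμ, inv_one]) w₁.isUnit L hL
  have s2 := tsum_eq_apply_inverse h' (c := μ) hμ w₂.isUnit L hL'
  have hs2 : Summable fun n : ℕ => μ ^ n * L (((u⁻¹ : Aˣ) : A) ^ n) := by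
    refine Summable.of_norm ?_
    simpa [hμ] using hL'
  -- The term of index `0` occurs in both one-sided series and must be counted once.
  rw [hs2.tsum_eq_zero_add] at s2
  have i1 : Ring.inverse (1 - μ⁻¹ • (u : A)) = μ • ((v⁻¹ : Aˣ) : A) := Ring.inverse_unit w₁
  have i2 : Ring.inverse (1 - μ • ((u⁻¹ : Aˣ) : A)) = -(((v⁻¹ : Aˣ) : A) * u) :=
    Ring.inverse_unit w₂
  rw [i1] at s1
  rw [i2] at s2
  rw [s1, eq_sub_iff_add_eq'.2 s2]
  simp only [pow_zero, one_mul]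
  rw [← map_sub, ← map_add]
  -- Both series are expressed by the same resolvent `v⁻¹`, where `v = μ - u`, and `v⁻¹ (μ - u) = 1`
  -- cancels them.
  have : μ • ((v⁻¹ : Aˣ) : A) + (-(((v⁻¹ : Aˣ) : A) * u) - 1) = 0 := by
    have h3 : ((v⁻¹ : Aˣ) : A) * (μ • 1 - u) = 1 := by rw [← hv, Units.inv_mul]
    rw [mul_sub, mul_smul_comm, mul_one] at h3
    rw [← h3]
    abel
  rw [this, map_zero]

end BanachAlgebra

/-! ### Poisson summation for `x₊ e^{-αx}` -/

section Poisson

open MeasureTheory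

/-- The function `x ↦ x₊ e^{-α x}`. -/
noncomputable def rampExp (α x : ℝ) : ℝ := max x 0 * Real.exp (-α * x)

theorem continuous_rampExp (α : ℝ) : Continuous (rampExp α) := by
  unfold rampExp
  fun_prop

theorem rampExp_of_nonpos (α : ℝ) {x : ℝ} (hx : x ≤ 0) : rampExp α x = 0 := by
  rw [rampExp, max_eq_right hx, zero_mul]

theorem rampExp_nonneg (α x : ℝ) : 0 ≤ rampExp α x :=
  mul_nonneg (le_max_right _ _) (Real.exp_pos _).le

theorem rampExp_isBigO {α : ℝ} (hα : 0 < α) :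
    (fun x => (rampExp α x : ℂ)) =O[Filter.cocompact ℝ] fun x : ℝ => |x| ^ (-2 : ℝ) := by
  rw [cocompact_eq_atBot_atTop, Asymptotics.isBigO_sup]
  constructor
  · refine (Asymptotics.isBigO_zero _ _).congr' ?_ Filter.EventuallyEq.rfl
    filter_upwards [Filter.eventually_le_atBot 0] with x hx
    simp [rampExp_of_nonpos α hx]
  -- The exponent `-3` leaves `-2` after multiplication by `x`.
  · have h1 := (isLittleO_exp_neg_mul_rpow_atTop hα (-3)).isBigO
    have h2 := (Asymptotics.isBigO_refl (fun x : ℝ => x) Filter.atTop).mul h1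
    refine (Asymptotics.IsBigO.of_norm_left (h2.norm_left.congr' ?_ ?_))
    · filter_upwards [Filter.eventually_ge_atTop 0] with x hx
      rw [Complex.norm_real, rampExp, max_eq_left hx]
    · filter_upwards [Filter.eventually_gt_atTop 0] with x hx
      rw [abs_of_pos hx]
      nth_rewrite 1 [← Real.rpow_one x]
      rw [← Real.rpow_add hx]
      norm_num

theorem integral_mul_exp_neg_mul_Ioi {c : ℂ} (hc : 0 < c.re) :
    ∫ x : ℝ in Set.Ioi 0, (x : ℂ) * Complex.exp (-c * x) = 1 / c ^ 2 := by
  have hc0 : c ≠ 0 := by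
    rintro rfl
    simp at hc
  have hnorm : ∀ x : ℝ, ‖Complex.exp (-c * x)‖ = Real.exp (-c.re * x) := by
    intro x
    rw [Complex.norm_exp]
    simp
  have hderiv : ∀ x ∈ Set.Ici (0 : ℝ), HasDerivAt
      (fun x : ℝ => -((x : ℂ) / c + 1 / c ^ 2) * Complex.exp (-c * x))
      ((x : ℂ) * Complex.exp (-c * x)) x := by
    intro x _
    have h1 : HasDerivAt (fun x : ℝ => (x : ℂ)) 1 x := Complex.ofRealCLM.hasDerivAt
    have h2 := ((h1.div_const c).add_const (1 / c ^ 2)).fun_neg.fun_mul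
      ((h1.const_mul (-c)).cexp)
    refine h2.congr_deriv ?_
    field_simp
    ring
  have htend0 : ∀ k : ℕ, Filter.Tendsto (fun x : ℝ => x ^ k * Real.exp (-c.re * x))
      Filter.atTop (𝓝 0) := by
    intro k
    have := tendsto_rpow_mul_exp_neg_mul_atTop_nhds_zero (k : ℝ) c.re hc
    simpa [Real.rpow_natCast] using this
  have hlim : Filter.Tendsto (fun x : ℝ => -((x : ℂ) / c + 1 / c ^ 2) * Complex.exp (-c * x))
      Filter.atTop (𝓝 0) := by
    rw [tendsto_zero_iff_norm_tendsto_zero]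
    have h1 := ((htend0 1).mul_const ‖c‖⁻¹).add ((htend0 0).mul_const (‖c‖ ^ 2)⁻¹)
    rw [zero_mul, zero_mul, add_zero] at h1
    refine squeeze_zero' (Filter.Eventually.of_forall fun x => norm_nonneg _) ?_ h1
    filter_upwards [Filter.eventually_ge_atTop 0] with x hx
    rw [norm_mul, norm_neg, hnorm]
    have : ‖(x : ℂ) / c + 1 / c ^ 2‖ ≤ x * ‖c‖⁻¹ + (‖c‖ ^ 2)⁻¹ := by
      refine (norm_add_le _ _).trans_eq ?_
      rw [norm_div, norm_div, norm_pow, Complex.norm_real, Real.norm_of_nonneg hx, norm_one,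
        one_div, div_eq_mul_inv]
    calc _ ≤ (x * ‖c‖⁻¹ + (‖c‖ ^ 2)⁻¹) * Real.exp (-c.re * x) := by gcongr
      _ = _ := by ring
  have hint : IntegrableOn (fun x : ℝ => (x : ℂ) * Complex.exp (-c * x)) (Set.Ioi 0) := by
    have h1 := integrableOn_rpow_mul_exp_neg_mul_rpow (p := 1) (s := 1) (b := c.re)
      (by norm_num) one_pos hc
    refine h1.mono' (by fun_prop) ?_
    refine (ae_restrict_iff' measurableSet_Ioi).2 (Filter.Eventually.of_forall fun x hx => ?_)
    rw [norm_mul, hnorm, Complex.norm_real, Real.norm_of_nonneg (le_of_lt hx), Real.rpow_one]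
  rw [integral_Ioi_of_hasDerivAt_of_tendsto' hderiv hint hlim]
  simp

open FourierTransform in
theorem fourier_rampExp {α : ℝ} (hα : 0 < α) (n : ℝ) :
    𝓕 (fun x => (rampExp α x : ℂ)) n = 1 / (α + 2 * Real.pi * n * Complex.I) ^ 2 := by
  rw [← integral_mul_exp_neg_mul_Ioi (c := α + 2 * Real.pi * n * Complex.I) (by simpa using hα),
    Real.fourier_eq', ← integral_indicator measurableSet_Ioi]
  refine integral_congr_ae (Filter.Eventually.of_forall fun x => ?_)
  simp only [Set.indicator, Set.mem_Ioi]
  split_ifs with hx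
  · rw [rampExp, max_eq_left hx.le, smul_eq_mul]
    push_cast
    rw [mul_left_comm, ← Complex.exp_add]
    congr 2
    simp
    ring
  · rw [rampExp_of_nonpos α (not_lt.1 hx)]
    simp

theorem summable_inv_add_mul_I_sq {α : ℝ} (hα : 0 < α) :
    Summable fun n : ℤ => 1 / ((α : ℂ) + 2 * Real.pi * n * Complex.I) ^ 2 := by
  have h1 : Summable fun n : ℤ => ((n : ℝ) ^ 2)⁻¹ := by
    have := Real.summable_one_div_int_pow (p := 2) |>.2 (by norm_num)
    simpa using this
  refine Summable.of_norm_bounded_eventually h1 ?_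
  rw [Filter.eventually_cofinite]
  refine (Set.finite_singleton (0 : ℤ)).subset fun n hn => ?_
  by_contra hn0
  refine hn ?_
  have hn0' : (n : ℝ) ≠ 0 := by exact_mod_cast hn0
  have hn2 : 0 < (n : ℝ) ^ 2 := by positivity
  rw [norm_div, norm_one, norm_pow, one_div, Complex.sq_norm, Complex.normSq_apply]
  gcongr
  simp
  nlinarith [Real.pi_gt_three, sq_nonneg α, mul_pos hn2 Real.pi_pos]

/-- Poisson summation turns the series into `∑ rampExp α (x + n)`, whose terms are nonnegative and
not all zero. -/
theorem tsum_fourier_rampExp_ne_zero {α : ℝ} (hα : 0 < α) (x : ℝ) :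
    ∑' n : ℤ, 1 / ((α : ℂ) + 2 * Real.pi * n * Complex.I) ^ 2 *
      Complex.exp (2 * Real.pi * Complex.I * x) ^ n ≠ 0 := by
  have hF := fun n : ℤ => fourier_rampExp hα n
  have h := Real.tsum_eq_tsum_fourier_of_rpow_decay_of_summable
    (f := fun x => (rampExp α x : ℂ)) (by have := continuous_rampExp α; fun_prop) one_lt_two
    (rampExp_isBigO hα) (by
      simp only [hF]
      exact_mod_cast summable_inv_add_mul_I_sq hα) x
  have h2 : ∑' n : ℤ, 1 / ((α : ℂ) + 2 * Real.pi * n * Complex.I) ^ 2 *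
      Complex.exp (2 * Real.pi * Complex.I * x) ^ n = ∑' n : ℤ, (rampExp α (x + n) : ℂ) := by
    rw [h]
    refine tsum_congr fun n => ?_
    rw [hF, fourier_coe_apply, ← Complex.exp_int_mul]
    congr 2
    push_cast
    ring
  rw [h2, ← Complex.ofReal_tsum, Complex.ofReal_ne_zero]
  have hs : Summable fun n : ℤ => rampExp α (x + n) := by
    have h3 : Filter.Tendsto (fun n : ℤ => x + n) Filter.cofinite (Filter.cocompact ℝ) :=
      (Homeomorph.addLeft x).isClosedEmbedding.tendsto_cocompact.comp Int.tendsto_coe_cofinite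
    have h4 := (Real.summable_one_div_int_add_rpow x 2).2 one_lt_two
    refine summable_of_isBigO h4 (((rampExp_isBigO hα).norm_left.comp_tendsto h3).congr ?_ ?_).of_norm_left
    · intro n
      simp
    · intro n
      simp only [Function.comp_apply]
      rw [Real.rpow_neg (abs_nonneg _), add_comm x, one_div]
  refine (hs.tsum_pos (fun n => rampExp_nonneg _ _) (⌈-x⌉ + 1) ?_).ne'
  have : 0 < x + ((⌈-x⌉ + 1 : ℤ) : ℝ) := by
    push_cast
    linarith [Int.le_ceil (-x)]
  rw [rampExp, max_eq_left this.le]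
  positivity

end Poisson

/-! ### Automorphisms of the disk are Möbius transformations -/

theorem diskMap_neg_leftInverse {b z : ℂ} (hb : ‖b‖ < 1) (hz : ‖z‖ ≤ 1) :
    diskMap 1 b (diskMap 1 (-b) z) = z := by
  have h1 := one_add_conj_mul_ne_zero (a := -b) (by rwa [norm_neg]) hz
  have h2 : (1 : ℂ) - conj b * b ≠ 0 := by
    rw [Complex.conj_mul', sub_ne_zero]
    intro h
    have h3 : ‖b‖ ^ 2 = 1 := by exact_mod_cast h.symm
    nlinarith [norm_nonneg b]
  rw [map_neg] at h1
  simp only [diskMap, one_mul, map_neg]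
  have e1 : (z + -b) / (1 + -conj b * z) + b = (1 - conj b * b) * z / (1 + -conj b * z) := by
    rw [div_add' _ _ _ h1]
    congr 1
    ring
  have e2 : 1 + conj b * ((z + -b) / (1 + -conj b * z)) =
      (1 - conj b * b) / (1 + -conj b * z) := by
    rw [mul_div_assoc', add_div' _ _ _ h1]
    congr 1
    ring
  rw [e1, e2, div_div_div_cancel_right₀ h1, mul_div_cancel_left₀ _ h2]

theorem differentiableAt_diskMap {c a z : ℂ} (ha : ‖a‖ < 1) (hz : ‖z‖ ≤ 1) :
    DifferentiableAt ℂ (diskMap c a) z := by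
  have h := one_add_conj_mul_ne_zero ha hz
  unfold diskMap
  fun_prop (disch := exact h)

/-- The inverse of an injective holomorphic function on a disk is holomorphic. -/
theorem differentiableOn_of_leftInvOn {f g : ℂ → ℂ}
    (hf : DifferentiableOn ℂ f (Metric.ball 0 1))
    (hbij : Set.BijOn f (Metric.ball 0 1) (Metric.ball 0 1))
    (hg : Set.InvOn g f (Metric.ball 0 1) (Metric.ball 0 1)) :
    DifferentiableOn ℂ g (Metric.ball 0 1) := by
  have hfa := hf.analyticOnNhd Metric.isOpen_ball
  have hgmaps : Set.MapsTo g (Metric.ball 0 1) (Metric.ball 0 1) := by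
    intro w hw
    obtain ⟨z, hz, rfl⟩ := hbij.surjOn hw
    rwa [hg.1 hz]
  have hhalf : (1 / 2 : ℂ) ∈ Metric.ball (0 : ℂ) 1 := by
    rw [mem_ball_zero_iff]
    norm_num
  have hnc : ¬ ∃ w, ∀ z ∈ Metric.ball (0 : ℂ) 1, f z = w := by
    rintro ⟨w, hw⟩
    have := hbij.injOn (Metric.mem_ball_self one_pos) hhalf
      ((hw 0 (Metric.mem_ball_self one_pos)).trans (hw _ hhalf).symm)
    norm_num at this
  -- The open mapping theorem makes `g` continuous. The zeros of `f'` are isolated, so `g` is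
  -- differentiable off isolated points, which are removable.
  have hopen := (hfa.is_constant_or_isOpen (convex_ball 0 1).isPreconnected).resolve_left hnc
  have hgcont : ∀ w ∈ Metric.ball (0 : ℂ) 1, ContinuousAt g w := by
    intro w hw
    rw [ContinuousAt, Filter.tendsto_def]
    intro s hs
    obtain ⟨t, hts, ht, hgt⟩ := mem_nhds_iff.1 (Filter.inter_mem hs
      (Metric.isOpen_ball.mem_nhds (hgmaps hw)))
    have h1 := hopen t (hts.trans Set.inter_subset_right) ht
    refine Filter.mem_of_superset (h1.mem_nhds ⟨g w, hgt, hg.2 hw⟩) ?_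
    rintro _ ⟨z, hz, rfl⟩
    rw [Set.mem_preimage, hg.1 (hts hz).2]
    exact (hts hz).1
  have hda : AnalyticOnNhd ℂ (deriv f) (Metric.ball 0 1) := hfa.deriv
  intro w hw
  refine (Complex.analyticAt_of_differentiable_on_punctured_nhds_of_continuousAt ?_
    (hgcont w hw)).differentiableAt.differentiableWithinAt
  have hne : ∀ᶠ z in 𝓝[≠] (g w), deriv f z ≠ 0 := by
    refine (hda _ (hgmaps hw)).eventually_eq_zero_or_eventually_ne_zero.resolve_left fun h0 => ?_
    have h1 := hda.eqOn_zero_of_preconnected_of_eventuallyEq_zero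
      (convex_ball 0 1).isPreconnected (hgmaps hw) h0
    refine hnc ⟨f 0, fun z hz => ?_⟩
    exact (convex_ball (0 : ℂ) 1).is_const_of_fderivWithin_eq_zero (𝕜 := ℂ) hf (fun x hx => by
      rw [fderivWithin_of_isOpen Metric.isOpen_ball hx]
      ext
      simpa using h1 hx) hz (Metric.mem_ball_self one_pos)
  have htend : Filter.Tendsto g (𝓝[≠] w) (𝓝[≠] (g w)) := by
    refine tendsto_nhdsWithin_iff.2 ⟨(hgcont w hw).tendsto.mono_left nhdsWithin_le_nhds, ?_⟩
    filter_upwards [self_mem_nhdsWithin, nhdsWithin_le_nhds (Metric.isOpen_ball.mem_nhds hw)]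
      with v hv hvb heq
    have h2 := congrArg f heq
    rw [hg.2 hvb, hg.2 hw] at h2
    exact hv h2
  filter_upwards [htend.eventually hne, nhdsWithin_le_nhds (Metric.isOpen_ball.mem_nhds hw)]
    with v hv hvb
  have h3 : HasDerivAt f (deriv f (g v)) (g v) :=
    (hf.differentiableAt (Metric.isOpen_ball.mem_nhds (hgmaps hvb))).hasDerivAt
  refine (h3.of_local_left_inverse (hgcont v hvb) hv ?_).differentiableAt
  filter_upwards [Metric.isOpen_ball.mem_nhds hvb] with x hx using hg.2 hx

/-- Every automorphism of the disk is a Möbius transformation. -/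
theorem IsDiskAutomorphism.exists_eqOn_diskMap {φ : ℂ → ℂ} (hφ : IsDiskAutomorphism φ) :
    ∃ c a : ℂ, ‖c‖ = 1 ∧ ‖a‖ < 1 ∧ Set.EqOn φ (diskMap c a) (Metric.ball 0 1) := by
  obtain ⟨hd, hbij⟩ := hφ
  have h0 : (0 : ℂ) ∈ Metric.ball (0 : ℂ) 1 := Metric.mem_ball_self one_pos
  set b := φ 0 with hb
  have hb1 : ‖b‖ < 1 := by simpa using hbij.mapsTo h0
  have hb1' : ‖-b‖ < 1 := by rwa [norm_neg]
  have hm : Set.MapsTo (diskMap 1 b) (Metric.ball 0 1) (Metric.ball 0 1) :=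
    mapsTo_diskMap norm_one hb1
  have hm' : Set.MapsTo (diskMap 1 (-b)) (Metric.ball 0 1) (Metric.ball 0 1) :=
    mapsTo_diskMap norm_one hb1'
  have hdm : ∀ a : ℂ, ‖a‖ < 1 → DifferentiableOn ℂ (diskMap 1 a) (Metric.ball 0 1) :=
    fun a ha z hz =>
      (differentiableAt_diskMap ha (mem_ball_zero_iff.1 hz).le).differentiableWithinAt
  set χ := Function.invFunOn φ (Metric.ball 0 1) with hχ
  have hinv : Set.InvOn χ φ (Metric.ball 0 1) (Metric.ball 0 1) := hbij.invOn_invFunOn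
  have hχd := differentiableOn_of_leftInvOn hd hbij hinv
  have hχm : Set.MapsTo χ (Metric.ball 0 1) (Metric.ball 0 1) := by
    intro w hw
    obtain ⟨z, hz, rfl⟩ := hbij.surjOn hw
    rwa [hinv.1 hz]
  have hψd : DifferentiableOn ℂ (diskMap 1 (-b) ∘ φ) (Metric.ball 0 1) :=
    (hdm _ hb1').comp hd hbij.mapsTo
  have hψm : Set.MapsTo (diskMap 1 (-b) ∘ φ) (Metric.ball 0 1) (Metric.ball 0 1) :=
    hm'.comp hbij.mapsTo
  have hψ0 : (diskMap 1 (-b) ∘ φ) 0 = 0 := by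
    simp [diskMap, ← hb]
  have hωd : DifferentiableOn ℂ (χ ∘ diskMap 1 b) (Metric.ball 0 1) := hχd.comp (hdm _ hb1) hm
  have hωm : Set.MapsTo (χ ∘ diskMap 1 b) (Metric.ball 0 1) (Metric.ball 0 1) := hχm.comp hm
  have hω0 : (χ ∘ diskMap 1 b) 0 = 0 := by
    have : diskMap 1 b 0 = φ 0 := by simp [diskMap, ← hb]
    rw [Function.comp_apply, this, hinv.1 h0]
  have hhalf : (1 / 2 : ℂ) ∈ Metric.ball (0 : ℂ) 1 := by
    rw [mem_ball_zero_iff]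
    norm_num
  -- Schwarz's lemma for `diskMap 1 (-b) ∘ φ` and for its inverse gives the two inequalities.
  -- Equality at one point forces a rotation `z ↦ C z`.
  have hnorm : ‖(diskMap 1 (-b) ∘ φ) (1 / 2)‖ = ‖(1 / 2 : ℂ)‖ := by
    refine le_antisymm ?_ ?_
    · exact Complex.norm_le_norm_of_mapsTo_ball hψd
        (hψm.mono_right Metric.ball_subset_closedBall) hψ0 (by norm_num)
    · have h1 := Complex.norm_le_norm_of_mapsTo_ball hωd
        (hωm.mono_right Metric.ball_subset_closedBall) hω0
        (z := (diskMap 1 (-b) ∘ φ) (1 / 2)) (by simpa using hψm hhalf)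
      have h2 : (χ ∘ diskMap 1 b) ((diskMap 1 (-b) ∘ φ) (1 / 2)) = 1 / 2 := by
        rw [Function.comp_apply, Function.comp_apply, diskMap_neg_leftInverse hb1
          (mem_ball_zero_iff.1 (hbij.mapsTo hhalf)).le, hinv.1 hhalf]
      rwa [h2] at h1
  obtain ⟨C, hC, hCeq⟩ := Complex.affine_of_mapsTo_ball_of_exists_norm_dslope_eq_div' (c := 0)
    (R₁ := 1) (R₂ := 1) hψd
    (by rw [hψ0]; exact hψm.mono_right Metric.ball_subset_closedBall)
    ⟨1 / 2, hhalf, by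
      rw [dslope_of_ne _ (by norm_num), slope_def_field, hψ0, sub_zero, sub_zero, norm_div, hnorm]
      norm_num⟩
  rw [div_one] at hC
  have hC0 : C ≠ 0 := by
    rintro rfl
    simp at hC
  have hconj : conj C = C⁻¹ := (Complex.inv_eq_conj hC).symm
  refine ⟨C, C⁻¹ * b, hC, by rwa [norm_mul, norm_inv, hC, inv_one, one_mul], fun z hz => ?_⟩
  have h1 := hCeq hz
  simp only [hψ0, zero_add, sub_zero, smul_eq_mul, Function.comp_apply] at h1
  have h3 := diskMap_neg_leftInverse (b := b) hb1 (mem_ball_zero_iff.1 (hbij.mapsTo hz)).le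
  rw [h1] at h3
  rw [← h3, diskMap, diskMap, map_mul, map_inv₀, hconj, inv_inv, one_mul, mul_add,
    mul_inv_cancel_left₀ hC0, mul_comm z C, mul_assoc C, mul_left_comm C]

/-! ### Normal form of parabolic automorphisms -/

/-- A parabolic automorphism is, up to a rotation, one of the maps `parabolicMap τ`. -/
theorem IsParabolicAutomorphism.exists_eqOn {φ : ℂ → ℂ} (hφ : IsParabolicAutomorphism φ) :
    ∃ (ζ : ℂ) (τ : ℝ), ‖ζ‖ = 1 ∧ τ ≠ 0 ∧
      Set.EqOn φ (fun z => ζ * parabolicMap τ (ζ⁻¹ * z)) (Metric.ball 0 1) := by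
  obtain ⟨haut, Φ, hΦ, hΦφ, ζ, hζ, hord⟩ := hφ
  obtain ⟨c, a, hc, ha, hca⟩ := haut.exists_eqOn_diskMap
  have hζmem : ζ ∈ {z ∈ Metric.sphere (0 : ℂ) 1 | Φ z = z} := by rw [hζ]; rfl
  have hζ1 : ‖ζ‖ = 1 := by simpa using hζmem.1
  have hζ0 : ζ ≠ 0 := by
    rintro rfl
    simp at hζ1
  have hζball : ζ ∈ Metric.closedBall (0 : ℂ) 1 := by simp [hζ1]
  have hden := one_add_conj_mul_ne_zero (z := ζ) ha hζ1.le
  have hden_ev : ∀ᶠ z in 𝓝 ζ, 1 + conj a * z ≠ 0 := by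
    have : Continuous fun z => 1 + conj a * z := by fun_prop
    exact this.continuousAt.eventually_ne hden
  -- near `ζ`, the continuation is the Möbius transformation
  have hev : ∀ᶠ z in 𝓝 ζ, Φ z = diskMap c a z := by
    have han : AnalyticAt ℂ (diskMap c a) ζ := by
      unfold diskMap
      fun_prop (disch := exact hden)
    refine ((hΦ ζ hζball).frequently_eq_iff_eventually_eq han).1 ?_
    have hcl : ζ ∈ closure (Metric.ball (0 : ℂ) 1) := by
      rwa [closure_ball _ one_ne_zero]
    have h1 : ∃ᶠ z in 𝓝 ζ, z ∈ Metric.ball (0 : ℂ) 1 := mem_closure_iff_frequently.1 hcl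
    rw [frequently_nhdsWithin_iff]
    refine h1.mono fun z hz => ⟨(hΦφ hz).trans (hca hz), ?_⟩
    rintro rfl
    rw [mem_ball_zero_iff, hζ1] at hz
    exact lt_irrefl _ hz
  -- the numerator of `Φ z - z` vanishes to order two
  have hord' : analyticOrderAt (fun z => c * (z + a) - z * (1 + conj a * z)) ζ = 2 := by
    have e1 : (fun z => c * (z + a) - z * (1 + conj a * z)) =ᶠ[𝓝 ζ]
        (fun z => Φ z - z) * fun z => 1 + conj a * z := by
      filter_upwards [hev, hden_ev] with z h1 h2
      rw [Pi.mul_apply, h1, diskMap, sub_mul, div_mul_cancel₀ _ h2]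
    have hanz : AnalyticAt ℂ (fun z => Φ z - z) ζ := (hΦ ζ hζball).fun_sub analyticAt_id
    have hanw : AnalyticAt ℂ (fun z => 1 + conj a * z) ζ := by fun_prop
    rw [analyticOrderAt_congr e1, analyticOrderAt_mul hanz hanw, hord,
      hanw.analyticOrderAt_eq_zero.2 hden, add_zero]
  have hanq : AnalyticAt ℂ (fun z => c * (z + a) - z * (1 + conj a * z)) ζ := by fun_prop
  have hq0 : c * (ζ + a) - ζ * (1 + conj a * ζ) = 0 := by
    by_contra hne
    rw [hanq.analyticOrderAt_eq_zero.2 hne] at hord'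
    norm_num at hord'
  obtain ⟨g, hg, hgζ, hgeq⟩ := (hanq.analyticOrderAt_eq_natCast (n := 2)).1 hord'
  have hq1 : c - (1 + conj a * ζ) - ζ * conj a = 0 := by
    have d1 : HasDerivAt (fun z => c * (z + a) - z * (1 + conj a * z))
        (c - (1 + conj a * ζ) - ζ * conj a) ζ := by
      have := (((hasDerivAt_id ζ).add_const a).const_mul c).sub
        ((hasDerivAt_id ζ).mul (((hasDerivAt_id ζ).const_mul (conj a)).const_add 1))
      refine this.congr_deriv ?_
      simp
      ring
    have d2 : HasDerivAt (fun z => (z - ζ) ^ 2 • g z) 0 ζ := by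
      have := (((hasDerivAt_id ζ).sub_const ζ).fun_pow 2).fun_smul hg.differentiableAt.hasDerivAt
      refine this.congr_deriv ?_
      simp
    exact d1.unique (d2.congr_of_eventuallyEq hgeq)
  -- For `a = 0` the derivative condition gives `c = 1`, so the map is the identity and the order is
  -- infinite.
  have ha0 : a ≠ 0 := by
    rintro rfl
    have hc1 : c = 1 := by simpa [sub_eq_zero] using hq1
    subst hc1
    have : analyticOrderAt (fun z : ℂ => 1 * (z + 0) - z * (1 + conj (0 : ℂ) * z)) ζ = ⊤ := by
      rw [analyticOrderAt_eq_top]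
      exact Filter.Eventually.of_forall fun z => by simp
    rw [this] at hord'
    exact absurd hord' (by decide)
  set p := conj a * ζ with hp
  have hp0 : p ≠ 0 := mul_ne_zero (by simpa using ha0) hζ0
  have hcp : c = 1 + 2 * p := by
    rw [hp]
    linear_combination hq1
  have hcap : c * a = -(ζ * p) := by
    linear_combination hq0 - ζ * hcp
  -- This is `|c| = 1` with `c = 1 + 2 p`; it makes `t` below real.
  have hpp : p + conj p + 2 * (p * conj p) = 0 := by
    have h1 : c * conj c = 1 := by
      rw [Complex.mul_conj', hc]
      norm_num
    rw [hcp, map_add, map_mul, map_one, map_ofNat] at h1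
    linear_combination h1 / 2
  have hden' : 1 + conj p ≠ 0 := by
    have h1 := (map_ne_zero (starRingEnd ℂ)).2 hden
    rwa [map_add, map_one] at h1
  -- After rotating `ζ` to `1` the map is `w ↦ (c w - p) / (1 + p w)`. Matching the denominator with
  -- `parabolicMap_eq` requires `I t / (2 + I t) = -p`.
  set t : ℂ := 2 * Complex.I * p / (1 + p) with ht
  have hconj : conj t = t := by
    rw [ht, map_div₀, map_mul, map_mul, map_add, map_one, map_ofNat, Complex.conj_I,
      div_eq_div_iff hden' hden]
    linear_combination (-2 * Complex.I) * hpp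
  have htre : (t.re : ℂ) = t := Complex.conj_eq_iff_re.1 hconj
  have hIt : Complex.I * t = -2 * p / (1 + p) := by
    rw [ht, mul_div_assoc']
    congr 1
    linear_combination (2 * p) * Complex.I_mul_I
  refine ⟨ζ, t.re, hζ1, ?_, fun z hz => ?_⟩
  · intro h0
    rw [h0, Complex.ofReal_zero] at htre
    have h1 : 2 * Complex.I * p ≠ 0 := mul_ne_zero (mul_ne_zero two_ne_zero Complex.I_ne_zero) hp0
    exact div_ne_zero h1 hden htre.symm
  · have e1 : (2 - Complex.I * t) * (ζ⁻¹ * z) + Complex.I * t =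
        2 * (c * (ζ⁻¹ * z) - p) / (1 + p) := by
      rw [hIt, hcp]
      field_simp
      ring
    have e2 : (2 + Complex.I * t) - Complex.I * t * (ζ⁻¹ * z) =
        2 * (1 + p * (ζ⁻¹ * z)) / (1 + p) := by
      rw [hIt]
      field_simp
      ring
    have e3 : p * (ζ⁻¹ * z) = conj a * z := by
      rw [hp, mul_assoc, mul_inv_cancel_left₀ hζ0]
    have e4 : ζ * (c * (ζ⁻¹ * z) - p) = c * (z + a) := by
      rw [mul_sub, mul_left_comm, mul_inv_cancel_left₀ hζ0, mul_add, hcap]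
      ring
    beta_reduce
    rw [hca hz, diskMap, parabolicMap_eq, htre, e1, e2, div_div_div_cancel_right₀ hden,
      mul_div_mul_left _ _ two_ne_zero, mul_div_assoc', e3, e4]

/-! ### The orbit sum and the spectrum -/

/-- The origin has coordinate `1`, and `1 - cayleyInv u = 2 / (u + 1)` at `u = 1 + iτ`. -/
theorem parabolicMap_apply_zero (τ : ℝ) : 1 - parabolicMap τ 0 = 1 / (1 + Complex.I * τ / 2) := by
  have h1 := two_add_I_mul_ne_zero τ
  have h2 : 1 + Complex.I * τ / 2 ≠ 0 := by
    have : 1 + Complex.I * τ / 2 = (2 + Complex.I * τ) / 2 := by ring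
    rw [this]
    exact div_ne_zero h1 two_ne_zero
  rw [parabolicMap_eq, eq_div_iff h2, mul_zero, mul_zero, zero_add, sub_zero]
  field_simp
  ring

theorem tsum_parabolic_orbit_ne_zero {τ : ℝ} (hτ : τ ≠ 0) {μ : ℂ} (hμ : ‖μ‖ = 1) :
    ∑' n : ℤ, μ ^ n * (1 / (1 + Complex.I * (n * τ) / 2)) ^ 2 ≠ 0 := by
  -- The reflection `n ↦ -n` replaces `(τ, μ)` by `(-τ, μ⁻¹)`.
  wlog hpos : 0 < τ generalizing τ μ
  · have h := this (τ := -τ) (neg_ne_zero.2 hτ) (μ := μ⁻¹) (by rw [norm_inv, hμ, inv_one])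
      (by simpa using lt_of_le_of_ne (not_lt.1 hpos) hτ)
    rw [← (Equiv.neg ℤ).tsum_eq] at h
    refine fun h0 => h (Eq.trans (tsum_congr fun n => ?_) h0)
    rw [Equiv.neg_apply, inv_zpow, zpow_neg, inv_inv, Int.cast_neg, Complex.ofReal_neg, neg_mul_neg]
  -- Chosen so that `α + 2 π i n = α (1 + i n τ / 2)`.
  set α : ℝ := 4 * Real.pi / τ with hα
  have hα0 : 0 < α := by positivity
  obtain ⟨x, hx⟩ : ∃ x : ℝ, Complex.exp (2 * Real.pi * Complex.I * x) = μ := by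
    refine ⟨μ.arg / (2 * Real.pi), ?_⟩
    have h1 := Complex.norm_mul_exp_arg_mul_I μ
    rw [hμ, Complex.ofReal_one, one_mul] at h1
    rw [← h1]
    congr 1
    have : (Real.pi : ℂ) ≠ 0 := by exact_mod_cast Real.pi_ne_zero
    rw [h1]
    push_cast
    field_simp
  have h := tsum_fourier_rampExp_ne_zero hα0 x
  rw [hx] at h
  have h2 : ∀ n : ℤ, μ ^ n * (1 / (1 + Complex.I * (n * τ) / 2)) ^ 2 =
      (α : ℂ) ^ 2 * (1 / ((α : ℂ) + 2 * Real.pi * n * Complex.I) ^ 2 * μ ^ n) := by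
    intro n
    have h3 : (α : ℂ) + 2 * Real.pi * n * Complex.I = α * (1 + Complex.I * (n * τ) / 2) := by
      have : (τ : ℂ) ≠ 0 := by exact_mod_cast hτ
      rw [hα]
      push_cast
      field_simp
      ring
    have h4 : (α : ℂ) ≠ 0 := by exact_mod_cast hα0.ne'
    rw [h3, mul_pow, div_pow, one_pow]
    field_simp
  simp only [h2]
  rw [tsum_mul_left]
  exact mul_ne_zero (pow_ne_zero _ (by exact_mod_cast hα0.ne')) h

theorem summable_parabolic_orbit {τ : ℝ} (hτ : τ ≠ 0) :
    Summable fun n : ℕ => ‖(1 / (1 + Complex.I * (n * τ) / 2)) ^ 2‖ := by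
  have h1 := (Real.summable_one_div_nat_pow (p := 2)).2 one_lt_two
  refine Summable.of_norm_bounded_eventually_nat (h1.mul_left (4 / τ ^ 2)) ?_
  filter_upwards [Filter.eventually_gt_atTop 0] with n hn
  have hn' : (0 : ℝ) < n := by exact_mod_cast hn
  have hτ2 : 0 < τ ^ 2 := by positivity
  rw [norm_norm, norm_pow, norm_div, norm_one, div_pow, one_pow, Complex.sq_norm]
  have h3 : Complex.normSq (1 + Complex.I * (n * τ) / 2) = 1 + (n : ℝ) ^ 2 * τ ^ 2 / 4 := by
    rw [Complex.normSq_apply]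
    simp
    ring
  rw [h3, div_mul_div_comm, mul_one, div_le_div_iff₀ (by positivity) (by positivity)]
  nlinarith

/-- The spectrum of a parabolic composition operator whose fixed point is `1`. -/
theorem spectrum_eq_sphere_of_parabolicMap {W : WeightSequence} (hW : W.PolynomialGrowth) {τ : ℝ}
    (hτ : τ ≠ 0) {T : WeightedHardySpace W →L[ℂ] WeightedHardySpace W}
    (hT : IsCompositionOperator W (parabolicMap τ) T) :
    spectrum ℂ T = Metric.sphere (0 : ℂ) 1 := by
  obtain ⟨S, hS⟩ := IsCompositionOperator.exists_parabolicMap hW (-τ)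
  have hTS : T * S = 1 := by
    refine IsCompositionOperator.unique ((hT.mul hS (mapsTo_parabolicMap τ)).congr
      (parabolicMap_add (-τ) τ)) ?_
    rw [neg_add_cancel, parabolicMap_zero]
    exact IsCompositionOperator.one
  have hST : S * T = 1 := by
    refine IsCompositionOperator.unique ((hS.mul hT (mapsTo_parabolicMap (-τ))).congr
      (parabolicMap_add τ (-τ))) ?_
    rw [add_neg_cancel, parabolicMap_zero]
    exact IsCompositionOperator.one
  let u : (WeightedHardySpace W →L[ℂ] WeightedHardySpace W)ˣ := ⟨T, S, hTS, hST⟩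
  have hTb := fun ε (hε : (0 : ℝ) < ε) => hT.parabolicMap_pow_bound hW hε
  have hSb := fun ε (hε : (0 : ℝ) < ε) => hS.parabolicMap_pow_bound hW hε
  refine Set.Subset.antisymm (fun μ hμ => ?_) fun μ hμ => ?_
  · have h1 : ‖μ‖ ≤ 1 := by simpa using spectrum_subset_closedBall_of_pow_bound hTb hμ
    have hμ0 : μ ≠ 0 := spectrum.ne_zero_of_mem_of_unit (a := u) hμ
    have h2 : μ⁻¹ ∈ spectrum ℂ S := by
      simpa only [Units.val_inv_eq_inv_val, Units.val_mk0] using!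
        (spectrum.inv_mem_iff (r := Units.mk0 μ hμ0) (a := u)).1 hμ
    have h3 : ‖μ⁻¹‖ ≤ 1 := by simpa using spectrum_subset_closedBall_of_pow_bound hSb h2
    rw [norm_inv] at h3
    rw [mem_sphere_zero_iff_norm]
    exact le_antisymm h1 ((inv_le_one₀ (norm_pos_iff.2 hμ0)).1 h3)
  · rw [mem_sphere_zero_iff_norm] at hμ
    by_contra hμT
    -- The double zero of `f` at the fixed point `1` makes the orbit values decay like `n⁻²`, hence
    -- summable.
    let f : WeightedHardySpace W := WeightedHardySpace.ofPoly W ((1 - Polynomial.X) ^ 2)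
    let L : (WeightedHardySpace W →L[ℂ] WeightedHardySpace W) →L[ℂ] ℂ :=
      (WeightedHardySpace.evalL W 0 (by simp)).comp (ContinuousLinearMap.apply ℂ _ f)
    have horb : ∀ (σ : ℝ) (R : WeightedHardySpace W →L[ℂ] WeightedHardySpace W),
        IsCompositionOperator W (parabolicMap σ) R →
        L R = (1 / (1 + Complex.I * σ / 2)) ^ 2 := by
      intro σ R hR
      have h1 : L R = (R f) 0 := rfl
      rw [h1, hR f 0 (Metric.mem_ball_self one_pos)]
      refine (WeightedHardySpace.ofPoly_apply _ _).trans ?_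
      rw [← parabolicMap_apply_zero]
      simp
    have hLT : ∀ n : ℕ, L (T ^ n) = (1 / (1 + Complex.I * (n * τ) / 2)) ^ 2 := fun n => by
      rw [horb _ _ (hT.parabolicMap_pow n)]
      push_cast
      rfl
    have hLS : ∀ n : ℕ, L (S ^ n) = (1 / (1 + Complex.I * (n * (-τ : ℝ)) / 2)) ^ 2 := fun n => by
      rw [horb _ _ (hS.parabolicMap_pow n)]
      push_cast
      rfl
    have hsT : Summable fun n : ℕ => ‖L (T ^ n)‖ := by
      simp only [hLT]
      exact summable_parabolic_orbit hτ
    have hsS : Summable fun n : ℕ => ‖L (S ^ n)‖ := by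
      simp only [hLS]
      exact summable_parabolic_orbit (neg_ne_zero.2 hτ)
    have hzero := tsum_orbit_eq_zero_of_notMem_spectrum (u := u) hTb hSb hμ hμT L hsT hsS
    have hμi : ‖μ⁻¹‖ = 1 := by rw [norm_inv, hμ, inv_one]
    refine tsum_parabolic_orbit_ne_zero hτ hμi ?_
    have hs1 : Summable fun n : ℕ => μ⁻¹ ^ n * L (T ^ n) := by
      refine Summable.of_norm ?_
      simpa [hμ] using hsT
    have hs2 : Summable fun n : ℕ => μ ^ (n + 1) * L (S ^ (n + 1)) := by
      refine Summable.of_norm ?_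
      simpa [hμ] using (summable_nat_add_iff 1).2 hsS
    refine Eq.trans (HasSum.of_nat_of_neg_add_one ?_ ?_).tsum_eq hzero
    · refine hs1.hasSum.congr_fun fun n => ?_
      rw [hLT]
      push_cast
      rw [zpow_natCast]
    · refine hs2.hasSum.congr_fun fun n => ?_
      rw [hLS, zpow_neg, inv_zpow, inv_inv, ← Nat.cast_succ, zpow_natCast, Complex.ofReal_neg,
        Int.cast_neg, neg_mul_comm, Int.cast_natCast]

theorem theorem3 (W : WeightSequence) (hW : W.PolynomialGrowth)
    (φ : ℂ → ℂ) (hφ : IsParabolicAutomorphism φ) :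
    (∃ T : WeightedHardySpace W →L[ℂ] WeightedHardySpace W, IsCompositionOperator W φ T) ∧
      ∀ T : WeightedHardySpace W →L[ℂ] WeightedHardySpace W,
        IsCompositionOperator W φ T → spectrum ℂ T = Metric.sphere (0 : ℂ) 1 := by
  obtain ⟨ζ, τ, hζ, hτ, hφeq⟩ := hφ.exists_eqOn
  have hζ0 : ζ ≠ 0 := by
    rintro rfl
    simp at hζ
  have hζi : ‖ζ⁻¹‖ = 1 := by rw [norm_inv, hζ, inv_one]
  obtain ⟨P, hP⟩ := IsCompositionOperator.exists_parabolicMap hW τ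
  obtain ⟨A, hA, -⟩ := exists_isCompositionOperator_rotation W hζ
  obtain ⟨B, hB, -⟩ := exists_isCompositionOperator_rotation W hζi
  have hrot : ∀ {c : ℂ}, ‖c‖ = 1 →
      Set.MapsTo (fun z => c * z) (Metric.ball (0 : ℂ) 1) (Metric.ball 0 1) := by
    intro c hc z hz
    rw [mem_ball_zero_iff] at hz ⊢
    rwa [norm_mul, hc, one_mul]
  have hBA : B * A = 1 := by
    refine IsCompositionOperator.unique ((hB.mul hA (hrot hζi)).congr fun z _ => ?_)
      IsCompositionOperator.one
    exact mul_inv_cancel_left₀ hζ0 z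
  have hAB : A * B = 1 := by
    refine IsCompositionOperator.unique ((hA.mul hB (hrot hζ)).congr fun z _ => ?_)
      IsCompositionOperator.one
    exact inv_mul_cancel_left₀ hζ0 z
  -- Conjugation by the rotation operators moves the fixed point from `1` to `ζ` and preserves the
  -- spectrum.
  have hBPA : IsCompositionOperator W φ (B * P * A) := by
    rw [mul_assoc]
    exact (hB.mul (hP.mul hA (mapsTo_parabolicMap τ)) (hrot hζi)).congr hφeq.symm
  refine ⟨⟨_, hBPA⟩, fun T hT => ?_⟩
  rw [hT.unique hBPA]
  let u : (WeightedHardySpace W →L[ℂ] WeightedHardySpace W)ˣ := ⟨B, A, hBA, hAB⟩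
  exact (spectrum.units_conjugate (a := P) (u := u)).trans
    (spectrum_eq_sphere_of_parabolicMap hW hτ hP)
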